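/- Let $k$ be an algebraically closed field of characteristic $p>0$ and let $q=p^e$ with $e\ge 1$. For a polynomial $F\in k[x,y,z,w]$ without constant term, the F-pure threshold of $F$ (at the origin) is $$\operatorname{fpt}(F)=\sup\left\{\tfrac{N}{p^{a}} \;:\; N,a\in\mathbb{Z}_{\ge 0},\ F^N\notin (x^{p^a},y^{p^a},z^{p^a},w^{p^a})\right\}.$$ An extremal surface of degree $q+1$ is a surface $X\subset\mathbb{P}^3_k$ defined by a reduced (squarefree) form $F$ of degree $q+1$ whose F-pure threshold is the smallest possible among all reduced forms of degree $q+1$ in $k[x,y,z,w]$. A quadric configuration on a surface of degree $d\ge 3$ in $\mathbb{P}^3$ is a collection of $2d$ lines on the surface consisting of two sets of $d$ pairwise skew lines such that each line in either set meets every line of the other set. Then every smooth extremal surface $X\subset\mathbb{P}^3_k$ of degree $q+1$ contains exactly $$\tfrac12\,(q^3+1)(q^2+1)\,q^4$$ quadric configurations. -/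

import Mathlib

open MvPolynomial

/-- The `e`-th Frobenius power `m^[p^e] = (x_i ^ (p^e))_i` of the homogeneous maximal ideal
`m = (x_i)_i` of a polynomial ring. -/
noncomputable def frobeniusPower {σ k : Type*} [Field k] (p e : ℕ) : Ideal (MvPolynomial σ k) :=
  Ideal.span (Set.range fun i : σ => (X i : MvPolynomial σ k) ^ p ^ e)

/-- The F-pure threshold (at the homogeneous maximal ideal `m`) of a polynomial `F ∈ m` over a
perfect field of characteristic `p`: the supremum of all `N / p ^ e` such that
`F ^ N ∉ m^[p^e]`. For `F ∈ m` this set contains `0` and is bounded above by `1`. -/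
noncomputable def fPureThreshold {σ k : Type*} [Field k] (p : ℕ) (F : MvPolynomial σ k) : ℝ :=
  sSup {t : ℝ | ∃ N e : ℕ, F ^ N ∉ frobeniusPower p e ∧ t = (N : ℝ) / (p : ℝ) ^ e}

/-- `F` defines an extremal surface of degree `d` in projective three-space: it is a reduced form
of degree `d` whose F-pure threshold is the smallest among all reduced forms of degree `d`. -/
def IsExtremalForm {k : Type*} [Field k] (p d : ℕ) (F : MvPolynomial (Fin 4) k) : Prop :=
  F.IsHomogeneous d ∧ Squarefree F ∧
    ∀ G : MvPolynomial (Fin 4) k, G.IsHomogeneous d → Squarefree G →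
      fPureThreshold p F ≤ fPureThreshold p G

/-- The projective surface `F = 0` is smooth (Jacobian criterion, for `F` homogeneous of positive
degree over an algebraically closed field): at every point of the surface some partial
derivative of `F` does not vanish. -/
def IsSmoothSurface {k : Type*} [Field k] (F : MvPolynomial (Fin 4) k) : Prop :=
  ∀ v : Fin 4 → k, v ≠ 0 → eval v F = 0 → ∃ i, eval v (pderiv i F) ≠ 0

/-- `L` is a line in projective three-space (a two-dimensional linear subspace of `k⁴`) that is
contained in the surface `F = 0`. -/
def IsLineOn {k : Type*} [Field k] (F : MvPolynomial (Fin 4) k)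
    (L : Submodule k (Fin 4 → k)) : Prop :=
  Module.finrank k L = 2 ∧ ∀ v ∈ L, eval v F = 0

/-- Two lines in projective three-space are skew if they have no common point, that is, if the
corresponding linear subspaces of `k⁴` have no common nonzero vector. -/
def AreSkew {k : Type*} [Field k] (L M : Submodule k (Fin 4 → k)) : Prop :=
  L ⊓ M = ⊥

/-- `C` is a quadric configuration on the surface `F = 0` of degree `d`: a collection of `2d`
lines on the surface that consists of two sets `A`, `B` of `d` (mutually) skew lines each, such
that each line in either set meets every line of the other set. -/
def IsQuadricConfiguration {k : Type*} [Field k] (F : MvPolynomial (Fin 4) k) (d : ℕ)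
    (C : Set (Submodule k (Fin 4 → k))) : Prop :=
  (∀ L ∈ C, IsLineOn F L) ∧ C.ncard = 2 * d ∧
    ∃ A B : Set (Submodule k (Fin 4 → k)),
      C = A ∪ B ∧ A.ncard = d ∧ B.ncard = d ∧
      A.Pairwise AreSkew ∧ B.Pairwise AreSkew ∧
      ∀ L ∈ A, ∀ M ∈ B, ¬ AreSkew L M

/-! ### F-pure thresholds and Frobenius forms. -/

section FrobeniusForms

variable {τ k : Type*} [Field k]

theorem mem_frobeniusPower {p a : ℕ} {g : MvPolynomial τ k} :
    g ∈ frobeniusPower p a ↔ ∀ m : τ →₀ ℕ, coeff m g ≠ 0 → ∃ i, p ^ a ≤ m i := by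
  have : (Set.range fun i : τ => (X i : MvPolynomial τ k) ^ p ^ a) =
      (fun s => monomial s (1 : k)) '' Set.range fun i : τ => Finsupp.single i (p ^ a) := by
    rw [← Set.range_comp]
    congr 1
    ext1 i
    simp [X_pow_eq_monomial]
  rw [frobeniusPower, this, mem_ideal_span_monomial_image]
  simp [Finsupp.single_le_iff]

/-- The generators have zero derivative in characteristic `p` when `a ≠ 0`, so the Leibniz rule
keeps the ideal stable. -/
theorem pderiv_mem_frobeniusPower {p a : ℕ} [CharP k p] (ha : a ≠ 0) {g : MvPolynomial τ k}
    (hg : g ∈ frobeniusPower p a) (i : τ) : pderiv i g ∈ frobeniusPower p a := by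
  induction hg using Submodule.span_induction with
  | mem x hx =>
    obtain ⟨j, rfl⟩ := hx
    simp [CharP.cast_eq_zero, ha]
  | zero => simp
  | add x y _ _ hx hy => rw [map_add]; exact add_mem hx hy
  | smul c x hxm hx =>
    rw [smul_eq_mul, pderiv_mul]
    exact add_mem (Ideal.mul_mem_left _ _ hxm) (Ideal.mul_mem_left _ _ hx)

theorem coeff_pow_frobenius {p : ℕ} [Fact p.Prime] [CharP k p] (b : ℕ) (F : MvPolynomial τ k)
    (m : τ →₀ ℕ) : coeff (p ^ b • m) (F ^ p ^ b) = coeff m F ^ p ^ b := by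
  have hp : p ^ b ≠ 0 := pow_ne_zero _ (Fact.out : p.Prime).ne_zero
  rw [← map_iterateFrobenius_expand, coeff_map, coeff_expand_smul _ hp, iterateFrobenius_def]

theorem dvd_of_coeff_pow_frobenius_ne_zero {p : ℕ} [Fact p.Prime] [CharP k p] {b : ℕ}
    {F : MvPolynomial τ k} {m : τ →₀ ℕ} (h : coeff m (F ^ p ^ b) ≠ 0) (i : τ) :
    p ^ b ∣ m i := by
  by_contra hi
  rw [← map_iterateFrobenius_expand, coeff_map, coeff_expand_of_not_dvd (h := hi), map_zero] at h
  exact h rfl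

/-- A special case of the flatness of Frobenius. -/
theorem eq_zero_of_mul_pow_mem_frobeniusPower {p : ℕ} [Fact p.Prime] [CharP k p] {a b d : ℕ}
    {F g : MvPolynomial τ k} (hF : F ∉ frobeniusPower p a) (hg : g.IsHomogeneous d)
    (hd : d < p ^ b) (h : g * F ^ p ^ b ∈ frobeniusPower p (a + b)) : g = 0 := by
  classical
  rw [mem_frobeniusPower] at hF h
  push Not at hF
  obtain ⟨α, hα, hαlt⟩ := hF
  have hlt : ∀ m, coeff m g ≠ 0 → ∀ i, m i < p ^ b := fun m hm i => by
    have h1 := hg hm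
    rw [Pi.one_def, ← Finsupp.degree_eq_weight_one] at h1
    exact (Finsupp.le_degree i m).trans_lt (h1 ▸ hd)
  by_contra hg0
  obtain ⟨β, hβ⟩ := ne_zero_iff.mp hg0
  -- No cancellation can occur: exponents of `F ^ p ^ b` are divisible by `p ^ b` and those of `g`
  -- are smaller than `p ^ b`, so reduction modulo `p ^ b` recovers the factor from `g`.
  have key : coeff (β + p ^ b • α) (g * F ^ p ^ b) = coeff β g * coeff α F ^ p ^ b := by
    rw [coeff_mul, Finset.sum_eq_single (β, p ^ b • α), coeff_pow_frobenius]
    · rintro ⟨x, y⟩ hxy hne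
      rw [Finset.HasAntidiagonal.mem_antidiagonal] at hxy
      by_contra hprod
      have hx := left_ne_zero_of_mul hprod
      have hy := right_ne_zero_of_mul hprod
      have hxβ : x = β := by
        ext i
        obtain ⟨c, hc⟩ := dvd_of_coeff_pow_frobenius_ne_zero hy i
        have h1 := DFunLike.congr_fun hxy i
        simp only [Finsupp.add_apply, Finsupp.smul_apply, smul_eq_mul, hc] at h1
        have h2 := congrArg (· % p ^ b) h1
        simpa [Nat.add_mul_mod_self_left, Nat.mod_eq_of_lt (hlt x hx i),
          Nat.mod_eq_of_lt (hlt β hβ i)] using h2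
      subst hxβ
      exact hne (Prod.ext rfl (add_left_cancel hxy))
    · intro hn
      simp at hn
  obtain ⟨i, hi⟩ := h (β + p ^ b • α) (by rw [key]; exact mul_ne_zero hβ (pow_ne_zero _ hα))
  have h1 := hlt β hβ i
  have h2 := hαlt i
  simp only [Finsupp.add_apply, Finsupp.smul_apply, smul_eq_mul, pow_add] at hi
  nlinarith

/-- If `e ≤ a` and `N ≥ p ^ (a - e)`, the Frobenius map sends `F` from `m^[p^e]` into `m^[p^a]`, and
`F ^ N` is a multiple of the image. If `a ≤ e`, the ideals are nested and `N ≠ 0` suffices. -/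
theorem mul_lt_of_pow_notMem_frobeniusPower {p : ℕ} {e N a : ℕ} (hp : 0 < p)
    {F : MvPolynomial τ k} (hF : F ∈ frobeniusPower p e) [Fact p.Prime] [CharP k p]
    (h : F ^ N ∉ frobeniusPower p a) : N * p ^ e < p ^ a := by
  by_contra! hle
  apply h
  rcases le_total e a with hea | hea
  · clear h
    obtain ⟨b, rfl⟩ := Nat.exists_eq_add_of_le hea
    have hb : p ^ b ≤ N := by
      rw [pow_add, mul_comm] at hle
      exact Nat.le_of_mul_le_mul_right hle (pow_pos hp e)
    rw [← Nat.sub_add_cancel hb, pow_add]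
    refine Ideal.mul_mem_left _ _ ?_
    induction hF using Submodule.span_induction with
    | mem x hx =>
      obtain ⟨j, rfl⟩ := hx
      simp only [← pow_mul, ← pow_add]
      exact Ideal.subset_span ⟨j, rfl⟩
    | zero => rw [zero_pow (pow_pos hp b).ne']; exact zero_mem _
    | add x y _ _ hx hy => rw [add_pow_char_pow]; exact add_mem hx hy
    | smul c x hxm hx => rw [smul_eq_mul, mul_pow]; exact Ideal.mul_mem_left _ _ hx
  · have hN : N ≠ 0 := by
      rintro rfl
      have := pow_pos hp a
      lia
    obtain ⟨n, rfl⟩ := Nat.exists_eq_succ_of_ne_zero hN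
    rw [pow_succ]
    refine Ideal.mul_mem_left _ _ ?_
    rw [mem_frobeniusPower] at hF ⊢
    exact fun m hm => (hF m hm).imp fun i hi => (Nat.pow_le_pow_right hp hea).trans hi

theorem fPureThreshold_le_of_mem_frobeniusPower {p e : ℕ} [Fact p.Prime] [CharP k p]
    {F : MvPolynomial τ k} (hF : F ∈ frobeniusPower p e) :
    fPureThreshold p F ≤ 1 / (p : ℝ) ^ e := by
  have hp : 0 < p := (Fact.out : p.Prime).pos
  refine Real.sSup_le ?_ (by positivity)
  rintro t ⟨N, a, hN, rfl⟩
  have h := mul_lt_of_pow_notMem_frobeniusPower hp hF hN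
  rw [div_le_div_iff₀ (by positivity) (by positivity), one_mul]
  exact_mod_cast h.le

/-- The content is that the set is bounded above: a monomial witnessing nonmembership has all
exponents below `p ^ b`, which bounds the degree `M * d` of the power. -/
theorem le_fPureThreshold [Fintype τ] {p d : ℕ} [Fact p.Prime] {F : MvPolynomial τ k}
    (hF : F.IsHomogeneous d) (hd : d ≠ 0) {N a : ℕ} (h : F ^ N ∉ frobeniusPower p a) :
    (N : ℝ) / (p : ℝ) ^ a ≤ fPureThreshold p F := by
  have hp : 0 < p := (Fact.out : p.Prime).pos
  refine le_csSup ⟨Fintype.card τ, ?_⟩ ⟨N, a, h, rfl⟩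
  rintro t ⟨M, b, hM, rfl⟩
  rw [mem_frobeniusPower] at hM
  push Not at hM
  obtain ⟨m, hm, hlt⟩ := hM
  have h1 := (hF.pow M) hm
  rw [Pi.one_def, ← Finsupp.degree_eq_weight_one, Finsupp.degree_eq_sum] at h1
  have h2 : ∑ i, m i ≤ Fintype.card τ * p ^ b := by
    simpa using Finset.sum_le_card_nsmul Finset.univ (fun i => m i) (p ^ b)
      fun i _ => (hlt i).le
  have h3 : M ≤ Fintype.card τ * p ^ b := by
    have := Nat.le_mul_of_pos_left M (Nat.pos_of_ne_zero hd)
    lia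
  rw [div_le_iff₀ (by positivity)]
  exact_mod_cast h3

/-- A form of degree `p ^ e + 1` with F-pure threshold at most `1 / p ^ e` is a Frobenius form. -/
theorem mem_frobeniusPower_of_fPureThreshold_le [Fintype τ] {p e : ℕ} [Fact p.Prime] [CharP k p]
    (he : e ≠ 0) {F : MvPolynomial τ k} (hF : F.IsHomogeneous (p ^ e + 1))
    (h : fPureThreshold p F ≤ 1 / (p : ℝ) ^ e) : F ∈ frobeniusPower p e := by
  by_contra hmem
  have hp : 0 < p := (Fact.out : p.Prime).pos
  -- As `(p^(e+1) + 1) / p^(2e+1) > 1 / p^e`, the power `F ^ (p^(e+1) + 1)` lies in `m^[p^(2e+1)]`.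
  -- Its derivative is `F ^ p^(e+1)` times that of `F`, and flatness of Frobenius kills the second
  -- factor, whose degree `p^e` is less than `p^(e+1)`.
  have hderiv : ∀ i, pderiv i F = 0 := fun i => by
    have hlt : p ^ e < p ^ (e + 1) :=
      Nat.pow_lt_pow_right (Fact.out : p.Prime).one_lt (Nat.lt_succ_self e)
    refine eq_zero_of_mul_pow_mem_frobeniusPower (d := p ^ e) (b := e + 1) hmem
      (by simpa using hF.pderiv (i := i)) hlt ?_
    have hN : F ^ (p ^ (e + 1) + 1) ∈ frobeniusPower p (e + (e + 1)) := by
      by_contra hN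
      have h1 := (le_fPureThreshold hF (Nat.succ_ne_zero _) hN).trans h
      rw [div_le_div_iff₀ (by positivity) (by positivity), one_mul, pow_add _ e (e + 1)] at h1
      push_cast at h1
      have : (0 : ℝ) < (p : ℝ) ^ e := by positivity
      nlinarith
    have := pderiv_mem_frobeniusPower (by lia) hN i
    rw [pderiv_pow, Nat.add_sub_cancel] at this
    have hcast : ((p ^ (e + 1) + 1 : ℕ) : MvPolynomial τ k) = 1 := by
      simp
    rwa [hcast, one_mul, mul_comm] at this
  -- Euler's identity, where the degree `p ^ e + 1` equals 1 in `k`, now forces `F = 0`.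
  have heul := hF.sum_X_mul_pderiv
  have hcast : ((p ^ e + 1 : ℕ) : MvPolynomial τ k) = 1 := by
    simp [he]
  simp only [hderiv, mul_zero, Finset.sum_const_zero, nsmul_eq_mul, hcast, one_mul] at heul
  exact hmem (heul ▸ zero_mem _)

/-- A monomial of degree `p ^ e + 1` with an exponent at least `p ^ e` has just one further variable
as cofactor. -/
theorem exists_matrix_of_mem_frobeniusPower [Fintype τ] {p e : ℕ} {F : MvPolynomial τ k}
    (hF : F.IsHomogeneous (p ^ e + 1)) (h : F ∈ frobeniusPower p e) :
    ∃ A : Matrix τ τ k, F = ∑ i, ∑ j, C (A i j) * (X i ^ p ^ e * X j) := by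
  classical
  have hmem : F ∈ Submodule.span k
      (Set.range fun x : τ × τ => (X x.1 ^ p ^ e * X x.2 : MvPolynomial τ k)) := by
    rw [F.as_sum]
    refine sum_mem fun m hm => ?_
    rw [mem_support_iff] at hm
    obtain ⟨i, hi⟩ := mem_frobeniusPower.mp h m hm
    have hdeg := hF hm
    rw [Pi.one_def, ← Finsupp.degree_eq_weight_one] at hdeg
    obtain ⟨m', rfl⟩ : ∃ m', m = Finsupp.single i (p ^ e) + m' :=
      ⟨m - Finsupp.single i (p ^ e),
        (add_tsub_cancel_of_le (Finsupp.single_le_iff.mpr hi)).symm⟩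
    rw [map_add, Finsupp.degree_single, add_right_inj] at hdeg
    obtain ⟨j, rfl⟩ := (Finsupp.sum_eq_one_iff _).mp hdeg
    have : monomial (Finsupp.single i (p ^ e) + Finsupp.single j 1)
        (coeff (Finsupp.single i (p ^ e) + Finsupp.single j 1) F) =
        (coeff (Finsupp.single i (p ^ e) + Finsupp.single j 1) F) •
          (X i ^ p ^ e * X j : MvPolynomial τ k) := by
      rw [X_pow_eq_monomial, X, monomial_mul, smul_monomial]
      simp
    rw [this]
    exact Submodule.smul_mem _ _ (Submodule.subset_span ⟨(i, j), rfl⟩)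
  obtain ⟨c, hc⟩ := (Submodule.mem_span_range_iff_exists_fun k).mp hmem
  refine ⟨fun i j => c (i, j), ?_⟩
  rw [← hc, Fintype.sum_prod_type]
  simp [smul_eq_C_mul]

/-- A repeated factor divides every partial derivative, in particular `X a ^ q` and `X c ^ q`, which
are coprime. -/
theorem squarefree_frobenius_form {q : ℕ} (hq : (q : k) = 0) {a b c d : τ} (hac : a ≠ c)
    (hbd : b ≠ d) :
    Squarefree (X a ^ q * X b + X c ^ q * X d : MvPolynomial τ k) := by
  intro h hdvd
  obtain ⟨g, hg⟩ := hdvd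
  have hdvd : ∀ i, h ∣ pderiv i (X a ^ q * X b + X c ^ q * X d : MvPolynomial τ k) := fun i => by
    rw [hg, pderiv_mul, pderiv_mul]
    exact ⟨pderiv i h * g + pderiv i h * g + h * pderiv i g, by ring⟩
  have hq' : (q : MvPolynomial τ k) = 0 := by rw [← map_natCast C, hq, map_zero]
  have h1 : h ∣ X a ^ q := by
    have := hdvd b
    simpa [pderiv_mul, pderiv_pow, hq', pderiv_X_of_ne hbd.symm] using this
  have h2 : h ∣ X c ^ q := by
    have := hdvd d
    simpa [pderiv_mul, pderiv_pow, hq', pderiv_X_of_ne hbd] using this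
  obtain ⟨n, -, hn⟩ := (dvd_prime_pow X_prime q).mp h1
  rcases Nat.eq_zero_or_pos n with rfl | hpos
  · rw [pow_zero] at hn
    exact associated_one_iff_isUnit.mp hn
  · have h3 : (X a : MvPolynomial τ k) ∣ X c ^ q :=
      ((dvd_pow_self _ hpos.ne').trans hn.symm.dvd).trans h2
    exact absurd (X_dvd_X.mp (X_prime.dvd_of_dvd_pow h3)) hac

theorem exists_matrix_of_isExtremalForm {p e : ℕ} [Fact p.Prime] [CharP k p] (he : e ≠ 0)
    {F : MvPolynomial (Fin 4) k} (hF : IsExtremalForm p (p ^ e + 1) F) :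
    ∃ A : Matrix (Fin 4) (Fin 4) k, F = ∑ i, ∑ j, C (A i j) * (X i ^ p ^ e * X j) := by
  obtain ⟨hhom, -, hmin⟩ := hF
  refine exists_matrix_of_mem_frobeniusPower hhom
    (mem_frobeniusPower_of_fPureThreshold_le he hhom ?_)
  refine (hmin (X 0 ^ p ^ e * X 1 + X 2 ^ p ^ e * X 3) ?_ ?_).trans
    (fPureThreshold_le_of_mem_frobeniusPower ?_)
  · simpa using (((isHomogeneous_X k _).pow _).mul (isHomogeneous_X _ _)).add
      (((isHomogeneous_X _ _).pow _).mul (isHomogeneous_X _ _))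
  · exact squarefree_frobenius_form (by simp [he]) (by decide) (by decide)
  · exact add_mem (Ideal.mul_mem_right _ _ (Ideal.subset_span ⟨0, rfl⟩))
      (Ideal.mul_mem_right _ _ (Ideal.subset_span ⟨2, rfl⟩))

/-- Differentiation sees only the linear factors `X j`, so the `q`-th root, taken coordinatewise, of
a vector in the left kernel of `A` is a singular point. -/
theorem isUnit_of_isSmoothSurface {p e : ℕ} [Fact p.Prime] [CharP k p] [IsAlgClosed k]
    (he : e ≠ 0) {F : MvPolynomial (Fin 4) k} (hF : IsSmoothSurface F)
    (A : Matrix (Fin 4) (Fin 4) k) (hA : F = ∑ i, ∑ j, C (A i j) * (X i ^ p ^ e * X j)) :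
    IsUnit A := by
  by_contra hu
  rw [Matrix.isUnit_iff_isUnit_det, isUnit_iff_ne_zero, not_not] at hu
  obtain ⟨w, hw0, hw⟩ := Matrix.exists_vecMul_eq_zero_iff.mpr hu
  have hpe : p ^ e ≠ 0 := pow_ne_zero _ (Fact.out : p.Prime).ne_zero
  have hroot : ∀ i, ∃ z : k, z ^ p ^ e = w i := fun i =>
    IsAlgClosed.exists_pow_nat_eq (w i) (Nat.pos_of_ne_zero hpe)
  choose v hv using hroot
  have hv0 : v ≠ 0 := by
    rintro rfl
    exact hw0 (funext fun i => by rw [← hv i]; exact zero_pow hpe)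
  have hw' : ∀ j, ∑ i, w i * A i j = 0 := fun j => congrFun hw j
  have heval : eval v F = 0 := by
    rw [hA]
    simp only [map_sum, map_mul, eval_C, map_pow, eval_X, hv]
    rw [Finset.sum_comm]
    refine Finset.sum_eq_zero fun j _ => ?_
    calc ∑ i, A i j * (w i * v j) = (∑ i, w i * A i j) * v j := by
          rw [Finset.sum_mul]; exact Finset.sum_congr rfl fun i _ => by ring
      _ = 0 := by rw [hw', zero_mul]
  obtain ⟨l, hl⟩ := hF v hv0 heval
  apply hl
  have hcast : ((p ^ e : ℕ) : MvPolynomial (Fin 4) k) = 0 := by simp [he]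
  have hd : ∀ i j, eval v (pderiv l (C (A i j) * (X i ^ p ^ e * X j))) =
      if j = l then w i * A i j else 0 := fun i j => by
    rw [pderiv_mul, pderiv_mul, pderiv_pow, pderiv_C, hcast]
    split_ifs with h
    · simp [h, hv, mul_comm]
    · simp [pderiv_X_of_ne h]
  rw [hA]
  simp only [map_sum, hd]
  simpa using hw' l

end FrobeniusForms

/-! ### Additive trinomials and the polynomials behind fixed vectors. -/

namespace Polynomial

variable {k : Type*} [Field k]

theorem natDegree_sparse_trinomial {n : ℕ} (hn : 2 ≤ n) {a : k} (ha : a ≠ 0) (b c : k) :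
    (C a * X ^ n + C b * X + C c).natDegree = n := by
  obtain ⟨n, rfl⟩ : ∃ m, n = m + 2 := ⟨n - 2, by lia⟩
  compute_degree!
  rwa [if_neg (by lia), add_zero]

theorem exists_trinomial_eq_zero [IsAlgClosed k] {n : ℕ} (hn : 2 ≤ n) {a : k} (ha : a ≠ 0)
    (b c : k) : ∃ t, a * t ^ n + b * t + c = 0 := by
  obtain ⟨t, ht⟩ := IsAlgClosed.exists_root (C a * X ^ n + C b * X + C c) (by
    intro h
    have := natDegree_sparse_trinomial hn ha b c
    have h' := natDegree_eq_of_degree_eq_some (n := 0) h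
    lia)
  exact ⟨t, by simpa [IsRoot] using ht⟩

/-- The derivative is the nonzero constant `b`, so the polynomial is separable. The later parameter
counts all come from this one. -/
theorem ncard_trinomial_eq_zero [IsAlgClosed k] {n : ℕ} (hn : 2 ≤ n) (hnk : (n : k) = 0) {a b : k}
    (ha : a ≠ 0) (hb : b ≠ 0) (c : k) :
    {t | a * t ^ n + b * t + c = 0}.Finite ∧ {t | a * t ^ n + b * t + c = 0}.ncard = n := by
  have hdeg := natDegree_sparse_trinomial hn ha b c
  have h0 : C a * X ^ n + C b * X + C c ≠ 0 := by
    intro h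
    rw [h, natDegree_zero] at hdeg
    lia
  have hset : {t | a * t ^ n + b * t + c = 0} = (C a * X ^ n + C b * X + C c).rootSet k := by
    ext t
    rw [mem_rootSet]
    simp [h0]
  have hsep : (C a * X ^ n + C b * X + C c).Separable := by
    rw [separable_def]
    have : derivative (C a * X ^ n + C b * X + C c) = C b := by
      simp [derivative_X_pow, hnk]
    rw [this]
    exact ⟨0, C b⁻¹, by rw [zero_mul, zero_add, ← C_mul, inv_mul_cancel₀ hb, C_1]⟩
  have hcard := card_rootSet_eq_natDegree (K := k) hsep (IsAlgClosed.splits _)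
  rw [hset]
  refine ⟨rootSet_finite _ _, ?_⟩
  rw [← Nat.card_coe_set_eq, Nat.card_eq_fintype_card, hcard, hdeg]

/-- The coefficients of a fixed vector of a Frobenius-semilinear map, as polynomials in the last
coefficient. -/
noncomputable def fixedVectorPoly (Q : ℕ) (c : ℕ → k) : ℕ → k[X]
  | 0 => C (c 0) * X ^ Q
  | i + 1 => fixedVectorPoly Q c i ^ Q + C (c (i + 1)) * X ^ Q

theorem X_pow_dvd_fixedVectorPoly {Q : ℕ} (hQ : Q ≠ 0) (c : ℕ → k) (i : ℕ) :
    X ^ Q ∣ fixedVectorPoly Q c i := by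
  induction i with
  | zero => exact dvd_mul_left _ _
  | succ i ih => exact dvd_add (ih.trans (dvd_pow_self _ hQ)) (dvd_mul_left _ _)

/-- The first summand of the recursion is divisible by `X ^ (Q * Q)`, so the coefficient of `X ^ Q`
is `c (i + 1)`; if that vanishes, descend. -/
theorem fixedVectorPoly_ne_zero {Q : ℕ} (hQ : 2 ≤ Q) {c : ℕ → k} {i j : ℕ}
    (hji : j ≤ i) (hj : c j ≠ 0) : fixedVectorPoly Q c i ≠ 0 := by
  induction i with
  | zero =>
    obtain rfl : j = 0 := by lia
    simpa [fixedVectorPoly] using hj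
  | succ i ih =>
    intro h
    obtain ⟨g, hg⟩ := X_pow_dvd_fixedVectorPoly (by lia : Q ≠ 0) c i
    have h1 : c (i + 1) = 0 := by
      have := congrArg (fun P => coeff P Q) h
      rw [fixedVectorPoly, hg, mul_pow, ← pow_mul] at this
      simpa [coeff_X_pow_mul', show ¬ Q * Q ≤ Q by nlinarith] using this
    rw [fixedVectorPoly, h1, C_0, zero_mul, add_zero] at h
    refine ih ?_ (eq_zero_of_pow_eq_zero h)
    rcases hji.lt_or_eq with h2 | rfl
    · lia
    · exact absurd h1 hj

/-- Writing the polynomial as `X ^ Q * g`, a root of `X ^ (Q - 1) * g - 1` is automatically nonzero.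
-/
theorem exists_fixedVectorPoly_eval_eq [IsAlgClosed k] {Q : ℕ} (hQ : 2 ≤ Q) {c : ℕ → k} {i j : ℕ}
    (hji : j ≤ i) (hj : c j ≠ 0) : ∃ t ≠ 0, eval t (fixedVectorPoly Q c i) = t := by
  obtain ⟨g, hg⟩ := X_pow_dvd_fixedVectorPoly (by lia : Q ≠ 0) c i
  have hg0 : g ≠ 0 := by
    rintro rfl
    exact fixedVectorPoly_ne_zero hQ hji hj (by rw [hg, mul_zero])
  obtain ⟨n, rfl⟩ : ∃ n, Q = n + 2 := ⟨Q - 2, by lia⟩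
  obtain ⟨t, ht⟩ := IsAlgClosed.exists_root (X ^ (n + 1) * g - C 1) (by
    rw [degree_sub_C] <;> rw [degree_mul, degree_X_pow, degree_eq_natDegree hg0]
    · norm_cast
      exact (by lia : n + 1 + g.natDegree ≠ 0)
    · norm_cast
      exact (by lia : 0 < n + 1 + g.natDegree))
  have ht' : t ^ (n + 1) * eval t g = 1 := by
    simpa [IsRoot, sub_eq_zero] using ht
  refine ⟨t, ?_, ?_⟩
  · rintro rfl
    simp at ht'
  · rw [hg]
    simp only [eval_mul, eval_pow, eval_X]
    linear_combination t * ht'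

end Polynomial

/-! ### Fixed vectors of Frobenius-semilinear maps. -/

section FrobeniusSemilinear

variable {k V : Type*} [Field k] [IsAlgClosed k] [AddCommGroup V] [Module k V] [Module.Finite k V]
  {τ : k →+* k} {Q : ℕ}

/-- In the orbit `f i` of a nonzero vector take the first relation `f (n+1) = ∑ c i • f i`. Then `∑
y i • f i` is fixed as soon as `y 0 = (y n)^Q c 0` and `y (i+1) = (y i)^Q + (y n)^Q c (i+1)`. With
`t = y n` as unknown, everything reduces to one equation in `t`. -/
theorem exists_fixed_vector [Nontrivial V] (hQ : 2 ≤ Q) (hτ : ∀ x, τ x = x ^ Q) {ψ : V →ₛₗ[τ] V}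
    (hψ : Function.Injective ψ) : ∃ u ≠ 0, ψ u = u := by
  obtain ⟨v, hv⟩ := exists_ne (0 : V)
  set f : ℕ → V := fun i => ψ^[i] v with hf
  have hfs : ∀ i, ψ (f i) = f (i + 1) := fun i => (Function.iterate_succ_apply' ψ i v).symm
  have hf0 : ∀ i, f i ≠ 0 := fun i => by
    induction i with
    | zero => exact hv
    | succ i ih => rw [← hfs]; exact (map_ne_zero_iff ψ hψ).mpr ih
  have hex : ∃ m, f m ∈ Submodule.span k (f '' (Finset.range m : Set ℕ)) := by
    obtain ⟨n, hn⟩ := monotone_stabilizes_iff_noetherian.mpr (inferInstance : IsNoetherian k V)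
      ⟨fun m => Submodule.span k (f '' (Finset.range m : Set ℕ)), fun a b hab =>
        Submodule.span_mono (Set.image_mono (by simpa using hab))⟩
    refine ⟨n, ?_⟩
    have := hn (n + 1) (Nat.le_succ n)
    change Submodule.span k _ = Submodule.span k _ at this
    rw [this]
    exact Submodule.subset_span ⟨n, by simp, rfl⟩
  classical
  obtain ⟨m, hm, hmin⟩ : ∃ m, f m ∈ Submodule.span k (f '' (Finset.range m : Set ℕ)) ∧
      ∀ l < m, f l ∉ Submodule.span k (f '' (Finset.range l : Set ℕ)) :=
    ⟨Nat.find hex, Nat.find_spec hex, fun l hl => Nat.find_min hex hl⟩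
  obtain ⟨n, rfl⟩ : ∃ n, m = n + 1 := by
    refine Nat.exists_eq_succ_of_ne_zero ?_
    rintro rfl
    exact hf0 0 (by simpa using hm)
  obtain ⟨c₀, hc₀⟩ := (Submodule.mem_span_image_finset_iff_exists_fun k).mp hm
  obtain ⟨c, hc⟩ : ∃ c : ℕ → k, ∑ i ∈ Finset.range (n + 1), c i • f i = f (n + 1) := by
    refine ⟨fun i => if h : i ∈ Finset.range (n + 1) then c₀ ⟨i, h⟩ else 0, ?_⟩
    rw [← hc₀, ← Finset.sum_coe_sort]
    exact Finset.sum_congr rfl fun i _ => by simp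
  obtain ⟨j, hj, hj0⟩ : ∃ j ≤ n, c j ≠ 0 := by
    by_contra! hall
    refine hf0 (n + 1) ?_
    rw [← hc]
    exact Finset.sum_eq_zero fun i hi => by
      rw [hall i (by simpa [Nat.lt_succ_iff] using hi), zero_smul]
  obtain ⟨t, ht0, ht⟩ := Polynomial.exists_fixedVectorPoly_eval_eq hQ hj hj0
  set y : ℕ → k := fun i => Polynomial.eval t (Polynomial.fixedVectorPoly Q c i) with hy
  have hy0 : y 0 = t ^ Q * c 0 := by simp only [hy, Polynomial.fixedVectorPoly, Polynomial.eval_mul,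
      Polynomial.eval_pow, Polynomial.eval_C, Polynomial.eval_X, mul_comm]
  have hys : ∀ i, y (i + 1) = y i ^ Q + t ^ Q * c (i + 1) := fun i => by
    simp only [hy, Polynomial.fixedVectorPoly, Polynomial.eval_add, Polynomial.eval_mul,
      Polynomial.eval_pow, Polynomial.eval_C, Polynomial.eval_X, mul_comm]
  have hyn : y n = t := ht
  refine ⟨∑ i ∈ Finset.range (n + 1), y i • f i, ?_, ?_⟩
  -- Since `t ≠ 0`, vanishing would express `f n` through its predecessors, against the minimality
  -- of the relation.
  · intro h0
    rw [Finset.sum_range_succ, hyn] at h0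
    refine hmin n (Nat.lt_succ_self n) ?_
    have : f n = -(t⁻¹ • ∑ i ∈ Finset.range n, y i • f i) := by
      rw [eq_neg_of_add_eq_zero_left h0, smul_neg, neg_neg, smul_smul, inv_mul_cancel₀ ht0,
        one_smul]
    rw [this]
    exact neg_mem (Submodule.smul_mem _ _ (sum_mem fun i hi =>
      Submodule.smul_mem _ _ (Submodule.subset_span ⟨i, hi, rfl⟩)))
  · rw [map_sum]
    simp only [LinearMap.map_smulₛₗ, hτ, hfs]
    rw [Finset.sum_range_succ, ← hc, hyn, Finset.smul_sum, Finset.sum_range_succ' (fun i => y i • f i),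
      Finset.sum_range_succ' (fun i => t ^ Q • c i • f i), ← add_assoc, ← Finset.sum_add_distrib]
    simp only [smul_smul, ← add_smul, hys, hy0]

/-- **Lang's theorem** for Frobenius-semilinear maps: the fixed vectors span. -/
theorem span_fixed_eq_top (hQ : 2 ≤ Q) (hτ : ∀ x, τ x = x ^ Q) {ψ : V →ₛₗ[τ] V}
    (hψ : Function.Injective ψ) : Submodule.span k {v | ψ v = v} = ⊤ := by
  set U := Submodule.span k {v | ψ v = v} with hU
  have hroot : ∀ c : k, ∃ t, t ^ Q = c := fun c => IsAlgClosed.exists_pow_nat_eq c (by lia)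
  have hUψ : ∀ u ∈ U, ψ u ∈ U := fun u hu => by
    induction hu using Submodule.span_induction with
    | mem x hx => rw [show ψ x = x from hx]; exact Submodule.subset_span hx
    | zero => simp
    | add x y _ _ hx hy => rw [map_add]; exact add_mem hx hy
    | smul c x _ hx => rw [LinearMap.map_smulₛₗ]; exact U.smul_mem _ hx
  have hUsurj : ∀ u ∈ U, ∃ w ∈ U, ψ w = u := fun u hu => by
    induction hu using Submodule.span_induction with
    | mem x hx => exact ⟨x, Submodule.subset_span hx, hx⟩
    | zero => exact ⟨0, zero_mem _, map_zero _⟩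
    | add x y _ _ hx hy =>
      obtain ⟨a, ha, rfl⟩ := hx
      obtain ⟨b, hb, rfl⟩ := hy
      exact ⟨a + b, add_mem ha hb, map_add _ _ _⟩
    | smul c x _ hx =>
      obtain ⟨a, ha, rfl⟩ := hx
      obtain ⟨t, rfl⟩ := hroot c
      exact ⟨t • a, U.smul_mem _ ha, by rw [LinearMap.map_smulₛₗ, hτ]⟩
  -- Surjectivity of `ψ - 1` on `U`: on multiples of a fixed vector it is the equation `t ^ Q - t =
  -- c`. As `ψ - 1` is not semilinear, scalar multiples need their own induction below.
  have hUsub : ∀ u ∈ U, ∃ w ∈ U, ψ w - w = u := fun u hu => by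
    have key : ∀ (c : k) (x : V), ψ x = x → ∃ w ∈ U, ψ w - w = c • x := fun c x hx => by
      obtain ⟨t, ht⟩ := Polynomial.exists_trinomial_eq_zero hQ (one_ne_zero (α := k)) (-1) (-c)
      refine ⟨t • x, U.smul_mem _ (Submodule.subset_span hx), ?_⟩
      rw [LinearMap.map_smulₛₗ, hτ, hx, ← sub_smul]
      congr 1
      linear_combination ht
    induction hu using Submodule.span_induction with
    | mem x hx => simpa using key 1 x hx
    | zero => exact ⟨0, zero_mem _, by simp⟩
    | add x y _ _ hx hy =>
      obtain ⟨a, ha, rfl⟩ := hx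
      obtain ⟨b, hb, rfl⟩ := hy
      exact ⟨a + b, add_mem ha hb, by rw [map_add]; abel⟩
    | smul c x hxm _ =>
      clear * - hxm key
      induction hxm using Submodule.span_induction generalizing c with
      | mem x hx => exact key c x hx
      | zero => exact ⟨0, zero_mem _, by simp⟩
      | add x y _ _ hx hy =>
        obtain ⟨a, ha, ha'⟩ := hx c
        obtain ⟨b, hb, hb'⟩ := hy c
        exact ⟨a + b, add_mem ha hb, by rw [map_add, smul_add, ← ha', ← hb']; abel⟩
      | smul d x _ hx => rw [smul_smul]; exact hx _
  -- Otherwise `ψ` induces an injective map on `V ⧸ U`, which has a nonzero fixed vector. Correcting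
  -- a lift by an element of `U` makes the lift itself fixed, so it lies in `U`.
  by_contra hne
  have : Nontrivial (V ⧸ U) := Submodule.Quotient.nontrivial_iff.mpr hne
  set φ : V ⧸ U →ₛₗ[τ] V ⧸ U := U.mapQ U ψ hUψ with hφ
  have hφinj : Function.Injective φ := by
    rw [injective_iff_map_eq_zero]
    intro x hx
    obtain ⟨w, rfl⟩ := U.mkQ_surjective x
    rw [Submodule.mkQ_apply, hφ, Submodule.mapQ_apply, Submodule.Quotient.mk_eq_zero] at hx
    obtain ⟨w', hw', h⟩ := hUsurj _ hx
    rw [hψ h] at hw'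
    simpa using hw'
  obtain ⟨x, hx0, hx⟩ := exists_fixed_vector hQ hτ hφinj
  obtain ⟨w, rfl⟩ := U.mkQ_surjective x
  rw [Submodule.mkQ_apply, hφ, Submodule.mapQ_apply, Submodule.Quotient.eq] at hx
  obtain ⟨t, htU, ht⟩ := hUsub _ hx
  have hfix : ψ (w - t) = w - t := by
    rw [map_sub, sub_eq_sub_iff_sub_eq_sub, ht]
  have hw : w ∈ U := by
    rw [← sub_add_cancel w t]
    exact add_mem (Submodule.subset_span hfix) htU
  exact hx0 (by simpa using hw)

theorem exists_fixed_vector_mem (hQ : 2 ≤ Q) (hτ : ∀ x, τ x = x ^ Q) {ψ : V →ₛₗ[τ] V}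
    (hψ : Function.Injective ψ) {W : Submodule k V} (hW : ∀ w ∈ W, ψ w ∈ W) (hW0 : W ≠ ⊥) :
    ∃ u ∈ W, u ≠ 0 ∧ ψ u = u := by
  have : Nontrivial W := Submodule.nontrivial_iff_ne_bot.mpr hW0
  let φ : W →ₛₗ[τ] W := (ψ.domRestrict W).codRestrict W fun w => hW w w.2
  have hφ : Function.Injective φ := fun x y h => Subtype.ext (hψ (congrArg Subtype.val h))
  obtain ⟨u, hu0, hu⟩ := exists_fixed_vector hQ hτ hφ
  exact ⟨u, u.2, by simpa using hu0, congrArg Subtype.val hu⟩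

theorem span_fixed_eq (hQ : 2 ≤ Q) (hτ : ∀ x, τ x = x ^ Q) {ψ : V →ₛₗ[τ] V}
    (hψ : Function.Injective ψ) {W : Submodule k V} (hW : ∀ w ∈ W, ψ w ∈ W) :
    Submodule.span k {v | v ∈ W ∧ ψ v = v} = W := by
  let φ : W →ₛₗ[τ] W := (ψ.domRestrict W).codRestrict W fun w => hW w w.2
  have hφ : Function.Injective φ := fun x y h => Subtype.ext (hψ (congrArg Subtype.val h))
  have h := congrArg (Submodule.map W.subtype) (span_fixed_eq_top hQ hτ hφ)
  rw [Submodule.map_span, Submodule.map_top, Submodule.range_subtype] at h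
  refine le_antisymm (Submodule.span_le.mpr fun v hv => hv.1) (h.symm.le.trans ?_)
  refine Submodule.span_mono ?_
  rintro _ ⟨v, hv, rfl⟩
  exact ⟨v.2, congrArg Subtype.val hv⟩

end FrobeniusSemilinear

/-! ### Linear algebra of lines in projective three-space. -/

section Lines

open Module

variable {k V : Type*} [Field k] [AddCommGroup V] [Module k V]

theorem exists_coords_of_finrank_eq_four (hV : finrank k V = 4) {a b c d : V}
    (h : ∀ x y z w : k, x • a + y • b + z • c + w • d = 0 → x = 0 ∧ y = 0 ∧ z = 0 ∧ w = 0)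
    (v : V) : ∃ x y z w : k, v = x • a + y • b + z • c + w • d := by
  have hli : LinearIndependent k ![a, b, c, d] := by
    rw [Fintype.linearIndependent_iff]
    intro g hg
    have h4 : g 0 • a + g 1 • b + g 2 • c + g 3 • d = 0 := by
      simpa [Fin.sum_univ_four] using hg
    obtain ⟨h0, h1, h2, h3⟩ := h _ _ _ _ h4
    intro i
    fin_cases i <;> assumption
  have : Module.Finite k V := Module.finite_of_finrank_pos (by lia)
  have hspan := hli.span_eq_top_of_card_eq_finrank' (by simp [hV])
  have hv : v ∈ Submodule.span k (Set.range ![a, b, c, d]) := hspan ▸ Submodule.mem_top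
  obtain ⟨g, hg⟩ := (Submodule.mem_span_range_iff_exists_fun k).mp hv
  exact ⟨g 0, g 1, g 2, g 3, by simpa [Fin.sum_univ_four] using hg.symm⟩

theorem finrank_span_pair {u v : V} (h : LinearIndependent k ![u, v]) :
    finrank k (Submodule.span k {u, v}) = 2 := by
  have hr : Set.range ![u, v] = {u, v} := by
    ext x
    simp [or_comm, eq_comm]
  have := finrank_span_eq_card h
  rwa [hr, Fintype.card_fin] at this

theorem eq_span_pair_of_mem {L : Submodule k V} (hL : finrank k L = 2) {u v : V}
    (h : LinearIndependent k ![u, v]) (hu : u ∈ L) (hv : v ∈ L) :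
    L = Submodule.span k {u, v} := by
  have : Module.Finite k L := Module.finite_of_finrank_pos (by lia)
  refine (Submodule.eq_of_le_of_finrank_eq (Submodule.span_le.mpr ?_) ?_).symm
  · rintro x (rfl | rfl) <;> assumption
  · rw [finrank_span_pair h, hL]

theorem linearIndependent_pair_of_notMem_span {u v : V} (hu : u ≠ 0)
    (hv : v ∉ Submodule.span k {u}) : LinearIndependent k ![u, v] := by
  rw [LinearIndependent.pair_iff' hu]
  rintro a rfl
  exact hv (Submodule.smul_mem _ _ (Submodule.mem_span_singleton_self u))

theorem exists_linearIndependent_pair_mem {s : Set V} (h : finrank k (Submodule.span k s) = 2) :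
    ∃ u ∈ s, ∃ v ∈ s, LinearIndependent k ![u, v] := by
  obtain ⟨u, hu, hu0⟩ : ∃ u ∈ s, u ≠ 0 := by
    by_contra! hall
    rw [Submodule.span_eq_bot.mpr hall, finrank_bot] at h
    lia
  obtain ⟨v, hv, hvu⟩ : ∃ v ∈ s, v ∉ Submodule.span k {u} := by
    by_contra! hall
    have h1 := Submodule.finrank_mono (Submodule.span_le.mpr hall)
    have h2 : finrank k (Submodule.span k {u}) ≤ 1 := by
      simpa using finrank_span_le_card ({u} : Set V) (R := k)
    lia
  exact ⟨u, hu, v, hv, linearIndependent_pair_of_notMem_span hu0 hvu⟩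

theorem exists_eq_span_pair {L : Submodule k V} (hL : finrank k L = 2) :
    ∃ u v, LinearIndependent k ![u, v] ∧ L = Submodule.span k {u, v} := by
  obtain ⟨u, hu, v, hv, h⟩ := exists_linearIndependent_pair_mem (s := (L : Set V))
    (by rwa [Submodule.span_eq])
  exact ⟨u, v, h, eq_span_pair_of_mem hL h hu hv⟩

theorem linearIndependent_pair_of_mem_of_mem {L M : Submodule k V} (hLM : L ⊓ M = ⊥) {u v : V}
    (hu : u ∈ L) (hv : v ∈ M) (hu0 : u ≠ 0) (hv0 : v ≠ 0) : LinearIndependent k ![u, v] := by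
  rw [LinearIndependent.pair_iff' hu0]
  rintro a rfl
  exact hv0 ((Submodule.eq_bot_iff _).mp hLM _ ⟨L.smul_mem a hu, hv⟩)

theorem exists_add_eq_of_inf_eq_bot [Module.Finite k V] {L M : Submodule k V}
    (hV : finrank k V = 4) (hL : finrank k L = 2) (hM : finrank k M = 2) (hLM : L ⊓ M = ⊥) (v : V) :
    ∃ l ∈ L, ∃ m ∈ M, l + m = v := by
  have h := Submodule.eq_top_of_disjoint L M (by rw [hL, hM, hV]) (disjoint_iff.mpr hLM)
  exact Submodule.mem_sup.mp (h ▸ Submodule.mem_top)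

end Lines

/-! ### Nondegenerate Frobenius forms, their isotropic lines and hyperbolic frames. -/

section FrobeniusForms

open Module

variable {k V : Type*} [Field k] [AddCommGroup V] [Module k V]

/-- A nondegenerate form on a four-dimensional space that is semilinear with respect to the `q`-th
power map in the first argument and linear in the second one, with its `q ^ 2`-semilinear
adjunction `ψ`. -/
structure IsFrobeniusForm (q : ℕ) (σ τ : k →+* k) (β : V →ₛₗ[σ] V →ₗ[k] k) (ψ : V →ₛₗ[τ] V) :
    Prop where
  two_le : 2 ≤ q
  cast_eq_zero : (q : k) = 0
  left_apply (x : k) : σ x = x ^ q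
  adj_apply (x : k) : τ x = x ^ q ^ 2
  finrank_eq : finrank k V = 4
  eq_zero_of_left {u : V} : (∀ v, β u v = 0) → u = 0
  adj (u v : V) : β u (ψ v) = β v u ^ q

/-- The two-dimensional totally isotropic subspaces of a Frobenius form. -/
def isotropicLines {σ : k →+* k} (β : V →ₛₗ[σ] V →ₗ[k] k) : Set (Submodule k V) :=
  {L | finrank k L = 2 ∧ ∀ u ∈ L, ∀ v ∈ L, β u v = 0}

theorem span_pair_mem_isotropicLines {σ : k →+* k} {β : V →ₛₗ[σ] V →ₗ[k] k} {u v : V}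
    (h : LinearIndependent k ![u, v]) (huu : β u u = 0) (huv : β u v = 0) (hvu : β v u = 0)
    (hvv : β v v = 0) : Submodule.span k {u, v} ∈ isotropicLines β := by
  refine ⟨finrank_span_pair h, fun a ha b hb => ?_⟩
  obtain ⟨x, y, rfl⟩ := Submodule.mem_span_pair.mp ha
  obtain ⟨z, w, rfl⟩ := Submodule.mem_span_pair.mp hb
  simp [huu, huv, hvu, hvv]

/-- A pair of bases of two totally isotropic lines that are dual to each other. -/
structure IsHyperbolicFrame {σ : k →+* k} (β : V →ₛₗ[σ] V →ₗ[k] k) (e f : Fin 2 → V) : Prop where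
  ee (i j) : β (e i) (e j) = 0
  ff (i j) : β (f i) (f j) = 0
  ef (i j) : β (e i) (f j) = if i = j then 1 else 0
  fe (i j) : β (f i) (e j) = if i = j then 1 else 0

theorem IsHyperbolicFrame.symm {σ : k →+* k} {β : V →ₛₗ[σ] V →ₗ[k] k} {e f : Fin 2 → V}
    (h : IsHyperbolicFrame β e f) : IsHyperbolicFrame β f e :=
  ⟨h.ff, h.ee, h.fe, h.ef⟩

/-- A binary form of degree `q + 1` has a nontrivial zero: either `(1, 0)`, or `t = 1` leaves a
polynomial of degree `q + 1` in `s`. -/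
theorem exists_isotropic_coords [IsAlgClosed k] {q : ℕ} (hq : 2 ≤ q) (A B C D : k) :
    ∃ s t : k, (s ≠ 0 ∨ t ≠ 0) ∧
      s ^ q * s * A + s ^ q * t * B + t ^ q * s * C + t ^ q * t * D = 0 := by
  by_cases hA : A = 0
  · exact ⟨1, 0, Or.inl one_ne_zero, by simp [hA, show q ≠ 0 by lia]⟩
  · obtain ⟨s, hs⟩ := IsAlgClosed.exists_root (Polynomial.C A * Polynomial.X ^ (q + 1) +
      Polynomial.C B * Polynomial.X ^ q + Polynomial.C C * Polynomial.X + Polynomial.C D) (by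
        intro h
        have h1 := Polynomial.natDegree_eq_of_degree_eq_some (n := 0) h
        have h2 : (Polynomial.C A * Polynomial.X ^ (q + 1) + Polynomial.C B * Polynomial.X ^ q +
            Polynomial.C C * Polynomial.X + Polynomial.C D).natDegree = q + 1 := by
          obtain ⟨n, rfl⟩ : ∃ m, q = m + 2 := ⟨q - 2, by lia⟩
          compute_degree!
        lia)
    refine ⟨s, 1, Or.inr one_ne_zero, ?_⟩
    have : A * s ^ (q + 1) + B * s ^ q + C * s + D = 0 := by simpa [Polynomial.IsRoot] using hs
    rw [one_pow]
    linear_combination this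

namespace IsFrobeniusForm

variable {q : ℕ} {σ τ : k →+* k} {β : V →ₛₗ[σ] V →ₗ[k] k} {ψ : V →ₛₗ[τ] V}

section
variable (H : IsFrobeniusForm q σ τ β ψ)
include H

theorem q_ne_zero : q ≠ 0 := by have := H.two_le; lia

theorem neg_pow (x : k) : (-x) ^ q = -x ^ q := by rw [← H.left_apply, map_neg, H.left_apply]

theorem add_pow (x y : k) : (x + y) ^ q = x ^ q + y ^ q := by
  simp only [← H.left_apply, map_add]

theorem two_le_sq : 2 ≤ q ^ 2 := by have := H.two_le; nlinarith

theorem finite : Module.Finite k V := Module.finite_of_finrank_pos (by rw [H.finrank_eq]; simp)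

theorem adj_injective : Function.Injective ψ := by
  rw [injective_iff_map_eq_zero]
  intro v hv
  refine H.eq_zero_of_left fun u => ?_
  have := H.adj u v
  rw [hv, map_zero] at this
  exact eq_zero_of_pow_eq_zero this.symm

theorem comm_of_fixed {v : V} (hv : ψ v = v) (u : V) : β u v = β v u ^ q := by
  rw [← H.adj, hv]

/-- Polarisation gives `t β(u,v) + t^q β(v,u) = 0` for all `t`. At `t = 1` this reads `β(v,u) =
-β(u,v)`, and a `t` with `t - t^q = 1` then gives `β(u,v) = 0`. Thus lines on the surface are
totally isotropic. -/
theorem isotropic_of_diag [IsAlgClosed k] {L : Submodule k V} (hL : ∀ v ∈ L, β v v = 0) :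
    ∀ u ∈ L, ∀ v ∈ L, β u v = 0 := by
  intro u hu v hv
  have key : ∀ t : k, t * β u v + t ^ q * β v u = 0 := fun t => by
    have h1 := hL _ (add_mem hu (L.smul_mem t hv))
    have h2 := hL u hu
    have h3 := hL v hv
    simpa [H.left_apply, h2, h3] using h1
  obtain ⟨t, ht⟩ := Polynomial.exists_trinomial_eq_zero H.two_le (one_ne_zero (α := k)) (-1) 1
  have h1 := key 1
  rw [one_pow] at h1
  linear_combination key t - t ^ q * h1 + β u v * ht

theorem mem_isotropicLines_iff [IsAlgClosed k] {L : Submodule k V} :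
    L ∈ isotropicLines β ↔ finrank k L = 2 ∧ ∀ v ∈ L, β v v = 0 :=
  ⟨fun h => ⟨h.1, fun v hv => h.2 v hv v hv⟩, fun h => ⟨h.1, H.isotropic_of_diag h.2⟩⟩

/-- Were `β v` zero on the kernel of `β u`, it would be a multiple of `β u`. A `q`-th root `c` of
the factor puts `c • u - v` in the left radical, against independence. -/
theorem exists_left_eq_zero_right_eq_one [IsAlgClosed k] {u v : V}
    (h : LinearIndependent k ![u, v]) : ∃ w, β u w = 0 ∧ β v w = 1 := by
  have hu : u ≠ 0 := by simpa using h.ne_zero 0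
  obtain ⟨f, hf⟩ : ∃ f, β u f ≠ 0 := by
    by_contra! hall
    exact hu (H.eq_zero_of_left hall)
  obtain ⟨g, hg, hg'⟩ : ∃ g, β u g = 0 ∧ β v g ≠ 0 := by
    by_contra! hall
    obtain ⟨c, hc⟩ := IsAlgClosed.exists_pow_nat_eq (β v f / β u f) (Nat.pos_of_ne_zero H.q_ne_zero)
    refine (LinearIndependent.pair_iff' hu).mp h c ?_
    rw [← sub_eq_zero]
    refine H.eq_zero_of_left fun w => ?_
    have h1 := hall (w - (β u w / β u f) • f) (by simp [hf])
    simp only [map_sub, map_smul, smul_eq_mul] at h1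
    simp only [map_sub, LinearMap.map_smulₛₗ, LinearMap.sub_apply, LinearMap.smul_apply,
      H.left_apply, hc, smul_eq_mul]
    linear_combination -h1
  exact ⟨(β v g)⁻¹ • g, by simp [hg], by simp [hg']⟩

theorem exists_dual_pair [IsAlgClosed k] {e : Fin 2 → V} (h : LinearIndependent k e) :
    ∃ f : Fin 2 → V, ∀ i j, β (e i) (f j) = if i = j then 1 else 0 := by
  have h01 : LinearIndependent k ![e 0, e 1] := by
    convert h using 1
    ext i
    fin_cases i <;> rfl
  have h10 : LinearIndependent k ![e 1, e 0] := LinearIndependent.pair_symm_iff.mp h01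
  obtain ⟨g, hg⟩ := H.exists_left_eq_zero_right_eq_one h01
  obtain ⟨f, hf⟩ := H.exists_left_eq_zero_right_eq_one h10
  refine ⟨![f, g], fun i j => ?_⟩
  fin_cases i <;> fin_cases j <;> simp [hg, hf]

/-- A totally isotropic line contains its orthogonal complement. -/
theorem mem_of_forall_eq_zero [IsAlgClosed k] {L : Submodule k V} (hL : L ∈ isotropicLines β)
    {w : V} (hw : ∀ u ∈ L, β u w = 0) : w ∈ L := by
  obtain ⟨u, v, h, rfl⟩ := exists_eq_span_pair hL.1
  have hu : u ∈ Submodule.span k {u, v} := Submodule.subset_span (by simp)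
  have hv : v ∈ Submodule.span k {u, v} := Submodule.subset_span (by simp)
  obtain ⟨f, hf⟩ := H.exists_dual_pair h
  have huf : β u (f 0) = 1 := by simpa using hf 0 0
  have huf' : β u (f 1) = 0 := by simpa using hf 0 1
  have hvf : β v (f 0) = 0 := by simpa using hf 1 0
  have hvf' : β v (f 1) = 1 := by simpa using hf 1 1
  have h1 : ∀ x y z t : k, β u (x • u + y • v + z • f 0 + t • f 1) = z := fun x y z t => by
    simp [hL.2 u hu u hu, hL.2 u hu v hv, huf, huf']
  have h2 : ∀ x y z t : k, β v (x • u + y • v + z • f 0 + t • f 1) = t := fun x y z t => by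
    simp [hL.2 v hv u hu, hL.2 v hv v hv, hvf, hvf']
  obtain ⟨x, y, z, t, hxyz⟩ := exists_coords_of_finrank_eq_four H.finrank_eq (a := u) (b := v)
    (c := f 0) (d := f 1) (fun x y z t h0 => by
      have hz := h1 x y z t
      have ht := h2 x y z t
      rw [h0, map_zero] at hz ht
      subst hz ht
      have := LinearIndependent.pair_iff.mp h x y (by simpa using h0)
      exact ⟨this.1, this.2, rfl, rfl⟩) w
  have hz := hw u hu
  have ht := hw v hv
  rw [hxyz, h1] at hz
  rw [hxyz, h2] at ht
  exact Submodule.mem_span_pair.mpr ⟨x, y, by rw [hxyz, hz, ht]; simp⟩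

/-- `β u (ψ v) = β v u ^ q` vanishes for `u ∈ L`, and `L` contains its orthogonal complement. This
is what makes Lang's theorem applicable to lines. -/
theorem adj_mem [IsAlgClosed k] {L : Submodule k V} (hL : L ∈ isotropicLines β) {v : V}
    (hv : v ∈ L) : ψ v ∈ L :=
  H.mem_of_forall_eq_zero hL fun u hu => by rw [H.adj, hL.2 v hv u hu, zero_pow H.q_ne_zero]

theorem exists_fixed_basis [IsAlgClosed k] {L : Submodule k V} (hL : L ∈ isotropicLines β) :
    ∃ e : Fin 2 → V, LinearIndependent k e ∧ L = Submodule.span k {e 0, e 1} ∧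
      ∀ i, ψ (e i) = e i := by
  have := H.finite
  obtain ⟨u, hu, v, hv, h⟩ := exists_linearIndependent_pair_mem
    (s := {v | v ∈ L ∧ ψ v = v}) (k := k) (by
      rw [span_fixed_eq H.two_le_sq H.adj_apply H.adj_injective fun w hw => H.adj_mem hL hw, hL.1])
  refine ⟨![u, v], h, eq_span_pair_of_mem hL.1 h hu.1 hv.1, fun i => ?_⟩
  fin_cases i
  · exact hu.2
  · exact hv.2

/-- Two skew totally isotropic lines have dual bases. -/
theorem exists_isHyperbolicFrame [IsAlgClosed k] {L M : Submodule k V}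
    (hL : L ∈ isotropicLines β) (hM : M ∈ isotropicLines β) (hLM : L ⊓ M = ⊥) :
    ∃ e f : Fin 2 → V, IsHyperbolicFrame β e f ∧ L = Submodule.span k {e 0, e 1} ∧
      M = Submodule.span k {f 0, f 1} := by
  have := H.finite
  obtain ⟨e, he, hLe, hfix⟩ := H.exists_fixed_basis hL
  have heL : ∀ i, e i ∈ L := fun i => by
    rw [hLe]
    fin_cases i <;> exact Submodule.subset_span (by simp)
  obtain ⟨g, hg⟩ := H.exists_dual_pair he
  -- Projecting the dual vectors `g i` to `M` along `L` keeps them dual to `e`, since `L` is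
  -- isotropic.
  have hdec : ∀ i, ∃ l ∈ L, ∃ m ∈ M, l + m = g i := fun i =>
    exists_add_eq_of_inf_eq_bot H.finrank_eq hL.1 hM.1 hLM (g i)
  choose l hl f hf hlf using hdec
  have hef : ∀ i j, β (e i) (f j) = if i = j then 1 else 0 := fun i j => by
    rw [← hg, ← hlf, map_add, hL.2 _ (heL i) _ (hl j), zero_add]
  refine ⟨e, f, ⟨fun i j => hL.2 _ (heL i) _ (heL j), fun i j => hM.2 _ (hf i) _ (hf j), hef,
    fun i j => ?_⟩, hLe, eq_span_pair_of_mem hM.1 ?_ (hf 0) (hf 1)⟩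
  -- Fixedness of `e j` transfers the duality to the other order of arguments, because 0 and 1 are
  -- their own `q`-th powers.
  · rw [H.comm_of_fixed (hfix j), hef]
    simp only [eq_comm (a := j)]
    split_ifs
    · rw [one_pow]
    · rw [zero_pow H.q_ne_zero]
  · rw [LinearIndependent.pair_iff]
    intro s t hst
    have h0 := congrArg (β (e 0)) hst
    have h1 := congrArg (β (e 1)) hst
    simp only [map_add, map_smul, hef, map_zero] at h0 h1
    exact ⟨by simpa using h0, by simpa using h1⟩

/-- Vectors dual to a fixed basis of `L` are corrected by elements of `L` until they span an
isotropic plane; the pairing with `L` does not change, so the plane is skew to `L`. -/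
theorem exists_skew [IsAlgClosed k] {L : Submodule k V} (hL : L ∈ isotropicLines β) :
    ∃ M ∈ isotropicLines β, L ⊓ M = ⊥ := by
  obtain ⟨e, he, hLe, hfix⟩ := H.exists_fixed_basis hL
  have heL : ∀ i, e i ∈ L := fun i => by
    rw [hLe]
    fin_cases i <;> exact Submodule.subset_span (by simp)
  have hee : ∀ i j, β (e i) (e j) = 0 := fun i j => hL.2 _ (heL i) _ (heL j)
  obtain ⟨f, hef⟩ := H.exists_dual_pair he
  have hfe : ∀ i j, β (f i) (e j) = if i = j then 1 else 0 := fun i j => by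
    rw [H.comm_of_fixed (hfix j), hef]
    simp only [eq_comm (a := j)]
    split_ifs
    · rw [one_pow]
    · rw [zero_pow H.q_ne_zero]
  obtain ⟨a, ha⟩ := Polynomial.exists_trinomial_eq_zero H.two_le (one_ne_zero (α := k)) 1 (β (f 0) (f 0))
  obtain ⟨d, hd⟩ := Polynomial.exists_trinomial_eq_zero H.two_le (one_ne_zero (α := k)) 1 (β (f 1) (f 1))
  -- The condition `β u v = 0` determines `c` from `b`; substituting into `β v u = 0` leaves this
  -- equation of degree `q ^ 2` for `b`.
  obtain ⟨b, hb⟩ := Polynomial.exists_trinomial_eq_zero H.two_le_sq (one_ne_zero (α := k)) (-1)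
    (β (f 0) (f 1) ^ q - β (f 1) (f 0))
  set c := -β (f 0) (f 1) - b ^ q with hc
  have hcq : c ^ q = -β (f 0) (f 1) ^ q - b ^ q ^ 2 := by
    rw [hc, sub_eq_add_neg, H.add_pow, H.neg_pow, H.neg_pow, ← pow_mul, ← sq, sub_eq_add_neg]
  set u := f 0 + a • e 0 + b • e 1 with hu
  set v := f 1 + c • e 0 + d • e 1 with hv
  have heu0 : β (e 0) u = 1 := by simp [hu, hee, hef]
  have heu1 : β (e 1) u = 0 := by simp [hu, hee, hef]
  have hev0 : β (e 0) v = 0 := by simp [hv, hee, hef]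
  have hev1 : β (e 1) v = 1 := by simp [hv, hee, hef]
  have hli : LinearIndependent k ![u, v] := by
    rw [LinearIndependent.pair_iff]
    intro s t hst
    have h0 := congrArg (β (e 0)) hst
    have h1 := congrArg (β (e 1)) hst
    simp only [map_add, map_smul, heu0, heu1, hev0, hev1, map_zero] at h0 h1
    exact ⟨by simpa using h0, by simpa using h1⟩
  refine ⟨Submodule.span k {u, v}, span_pair_mem_isotropicLines hli ?_ ?_ ?_ ?_, ?_⟩
  · simp [hu, hee, hef, hfe, H.left_apply]
    linear_combination ha
  · simp [hu, hv, hee, hef, hfe, H.left_apply]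
    linear_combination hc
  · simp [hu, hv, hee, hef, hfe, H.left_apply]
    linear_combination hcq - hb
  · simp [hv, hee, hef, hfe, H.left_apply]
    linear_combination hd
  · rw [Submodule.eq_bot_iff]
    rintro x ⟨hxL, hx⟩
    obtain ⟨s, t, rfl⟩ := Submodule.mem_span_pair.mp hx
    have h0 := hL.2 _ (heL 0) _ hxL
    have h1 := hL.2 _ (heL 1) _ hxL
    simp only [map_add, map_smul, heu0, heu1, hev0, hev1, smul_eq_mul, mul_one, mul_zero,
      add_zero, zero_add] at h0 h1
    simp [h0, h1]

/-- If a fixed `u` is not isotropic, the kernel of `β u` is `ψ`-stable and contains a fixed `v`. If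
`v` is not isotropic either, solve `β u u + t^(q+1) β v v = 0`: both diagonal values equal their
`q`-th powers, whence `t^(q²) = t`, and `u + t • v` stays fixed. -/
theorem exists_fixed_isotropic [IsAlgClosed k] : ∃ v ≠ 0, ψ v = v ∧ β v v = 0 := by
  have := H.finite
  have : Nontrivial V := Module.nontrivial_of_finrank_pos (R := k) (by rw [H.finrank_eq]; simp)
  obtain ⟨u, hu0, hu⟩ := exists_fixed_vector H.two_le_sq H.adj_apply H.adj_injective
  by_cases huu : β u u = 0
  · exact ⟨u, hu0, hu, huu⟩
  obtain ⟨v, hv, hv0, hvfix⟩ := exists_fixed_vector_mem H.two_le_sq H.adj_apply H.adj_injective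
    (W := LinearMap.ker (β u)) (fun w hw => by
      rw [LinearMap.mem_ker] at hw ⊢
      rw [H.adj, H.comm_of_fixed hu, hw, zero_pow H.q_ne_zero, zero_pow H.q_ne_zero])
    (LinearMap.ker_ne_bot_of_finrank_lt (by rw [H.finrank_eq]; simp))
  rw [LinearMap.mem_ker] at hv
  by_cases hvv : β v v = 0
  · exact ⟨v, hv0, hvfix, hvv⟩
  have hvu : β v u = 0 := by rw [H.comm_of_fixed hu, hv, zero_pow H.q_ne_zero]
  obtain ⟨t, ht⟩ := IsAlgClosed.exists_pow_nat_eq (-β u u / β v v) (Nat.succ_pos q)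
  have htq : t ^ q ^ 2 = t := by
    have ht0 : t ≠ 0 := by
      rintro rfl
      rw [zero_pow (Nat.succ_ne_zero q), eq_comm, div_eq_zero_iff, neg_eq_zero] at ht
      exact ht.elim huu hvv
    have h1 : (t ^ (q + 1)) ^ q = t ^ (q + 1) := by
      rw [ht, div_pow, H.neg_pow, ← H.comm_of_fixed hu, ← H.comm_of_fixed hvfix]
    refine mul_right_cancel₀ (pow_ne_zero q ht0) ?_
    rw [← pow_succ', ← h1]
    ring
  refine ⟨u + t • v, fun h0 => ?_, ?_, ?_⟩
  · have := congrArg (β u) h0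
    simp [hv, huu] at this
  · rw [map_add, LinearMap.map_smulₛₗ, H.adj_apply, htq, hu, hvfix]
  · simp only [map_add, LinearMap.map_smulₛₗ, LinearMap.add_apply, LinearMap.smul_apply, hv, hvu,
      H.left_apply, map_smul, smul_eq_mul]
    rw [pow_succ, eq_div_iff hvv] at ht
    linear_combination ht

/-- For a fixed isotropic `v`, the kernel of `β v` has dimension at least 3. It therefore contains a
plane avoiding `v`, and this plane contains an isotropic vector, which spans an isotropic line with
`v`. -/
theorem isotropicLines_nonempty [IsAlgClosed k] : (isotropicLines β).Nonempty := by
  have := H.finite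
  obtain ⟨v, hv0, hv, hvv⟩ := H.exists_fixed_isotropic
  have hW : 3 ≤ finrank k (LinearMap.ker (β v)) := by
    have h1 := LinearMap.finrank_range_add_finrank_ker (β v)
    have h2 := Submodule.finrank_le (LinearMap.range (β v))
    rw [finrank_self] at h2
    rw [H.finrank_eq] at h1
    lia
  have hex : ∀ s : Finset V, s.card < 3 → ∃ w, β v w = 0 ∧ w ∉ Submodule.span k (s : Set V) := by
    intro s hs
    by_contra! hall
    have h1 := Submodule.finrank_mono (show LinearMap.ker (β v) ≤ Submodule.span k (s : Set V) from
      fun w hw => hall w hw)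
    exact absurd (hW.trans (h1.trans (finrank_span_finset_le_card (R := k) s))) (by lia)
  classical
  obtain ⟨x, hx, hxv⟩ := hex {v} (by simp)
  obtain ⟨y, hy, hyv⟩ := hex {v, x} (by
    have := Finset.card_le_two (a := v) (b := x)
    lia)
  simp only [Finset.coe_singleton, Finset.coe_insert] at hxv hyv
  obtain ⟨s, t, hst, h⟩ := exists_isotropic_coords H.two_le (β x x) (β x y) (β y x) (β y y)
  have hvw : β v (s • x + t • y) = 0 := by simp [hx, hy]
  refine ⟨Submodule.span k {v, s • x + t • y}, span_pair_mem_isotropicLines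
    (linearIndependent_pair_of_notMem_span hv0 fun hmem => ?_) hvv hvw
    (by rw [H.comm_of_fixed hv, hvw, zero_pow H.q_ne_zero]) ?_⟩
  · obtain ⟨c, hc⟩ := Submodule.mem_span_singleton.mp hmem
    by_cases ht : t = 0
    · subst ht
      have hs : s ≠ 0 := by simpa using hst
      refine hxv (Submodule.mem_span_singleton.mpr ⟨s⁻¹ * c, ?_⟩)
      rw [mul_smul, hc, zero_smul, add_zero, inv_smul_smul₀ hs]
    · refine hyv (Submodule.mem_span_pair.mpr ⟨t⁻¹ * c, -(t⁻¹ * s), ?_⟩)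
      rw [mul_smul, hc, smul_add, inv_smul_smul₀ ht, neg_smul, mul_smul]
      abel
  · simp only [map_add, LinearMap.map_smulₛₗ, LinearMap.add_apply, LinearMap.smul_apply,
      H.left_apply, map_smul, smul_eq_mul]
    linear_combination h

end

end IsFrobeniusForm

end FrobeniusForms

/-! ### Lines skew to a given line, as graphs in a hyperbolic frame. -/

section FrobeniusForms

open Module

variable {k V : Type*} [Field k] [AddCommGroup V] [Module k V]

theorem inf_ne_bot_iff {L M : Submodule k V} : L ⊓ M ≠ ⊥ ↔ ∃ x ∈ L, x ∈ M ∧ x ≠ 0 := by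
  rw [Submodule.ne_bot_iff]
  simp only [Submodule.mem_inf, and_assoc]

namespace IsHyperbolicFrame

variable {σ : k →+* k} {β : V →ₛₗ[σ] V →ₗ[k] k} {e f : Fin 2 → V}

theorem eq_zero (h : IsHyperbolicFrame β e f) (x y z w : k)
    (h0 : x • e 0 + y • e 1 + z • f 0 + w • f 1 = 0) : x = 0 ∧ y = 0 ∧ z = 0 ∧ w = 0 := by
  have h1 := congrArg (β (f 0)) h0
  have h2 := congrArg (β (f 1)) h0
  have h3 := congrArg (β (e 0)) h0
  have h4 := congrArg (β (e 1)) h0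
  simp [h.ee, h.ff, h.ef, h.fe] at h1 h2 h3 h4
  exact ⟨h1, h2, h3, h4⟩

end IsHyperbolicFrame

namespace IsFrobeniusForm

variable {q : ℕ} {σ τ : k →+* k} {β : V →ₛₗ[σ] V →ₗ[k] k} {ψ : V →ₛₗ[τ] V}

/-- The lines skew to `⟨f 0, f 1⟩`, in terms of a hyperbolic frame. -/
def graphLine (q : ℕ) (e f : Fin 2 → V) (t : k × k × k) : Submodule k V :=
  Submodule.span k {e 0 + t.1 • f 0 + t.2.1 • f 1, e 1 - t.2.1 ^ q • f 0 + t.2.2 • f 1}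

/-- The solutions of `x ^ q = -x`. -/
def antiFixed (k : Type*) [Field k] (q : ℕ) : Set k := {x | 1 * x ^ q + 1 * x + 0 = 0}

/-- The solutions of `x ^ q ^ 2 = x`. -/
def sqFixed (k : Type*) [Field k] (q : ℕ) : Set k := {x | 1 * x ^ q ^ 2 + (-1) * x + 0 = 0}

theorem mem_antiFixed {x : k} : x ∈ antiFixed k q ↔ x ^ q + x = 0 := by simp [antiFixed]

theorem mem_sqFixed {x : k} : x ∈ sqFixed k q ↔ x ^ q ^ 2 = x := by
  simp [sqFixed, ← sub_eq_add_neg, sub_eq_zero]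

/-- The parameters of the lines skew to a given line. -/
def graphParams (k : Type*) [Field k] (q : ℕ) : Set (k × k × k) :=
  antiFixed k q ×ˢ sqFixed k q ×ˢ antiFixed k q

section
variable (H : IsFrobeniusForm q σ τ β ψ) {e f : Fin 2 → V} (h : IsHyperbolicFrame β e f)
include H

/-- The redundant coefficients in the definitions of `antiFixed` and `sqFixed` make both sets
trinomial zero sets on the nose. -/
theorem antiFixed_finite_ncard [IsAlgClosed k] :
    (antiFixed k q).Finite ∧ (antiFixed k q).ncard = q :=
  Polynomial.ncard_trinomial_eq_zero H.two_le H.cast_eq_zero one_ne_zero one_ne_zero 0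

theorem sqFixed_finite_ncard [IsAlgClosed k] :
    (sqFixed k q).Finite ∧ (sqFixed k q).ncard = q ^ 2 :=
  Polynomial.ncard_trinomial_eq_zero H.two_le_sq (by simp [H.cast_eq_zero]) one_ne_zero (by simp) 0

include h

theorem graphLine_mem_isotropicLines {t : k × k × k} (ht : t ∈ graphParams k q) :
    graphLine q e f t ∈ isotropicLines β := by
  obtain ⟨a, b, d⟩ := t
  obtain ⟨ha, hb, hd⟩ := ht
  simp only [mem_antiFixed, mem_sqFixed] at ha hb hd
  refine span_pair_mem_isotropicLines ?_ ?_ ?_ ?_ ?_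
  · rw [LinearIndependent.pair_iff]
    intro x y hxy
    have h0 := congrArg (β (f 0)) hxy
    have h1 := congrArg (β (f 1)) hxy
    simp [h.ff, h.fe] at h0 h1
    exact ⟨h0, h1⟩
  · simp [h.ee, h.ff, h.ef, h.fe, H.left_apply]
    linear_combination ha
  · simp [h.ee, h.ff, h.ef, h.fe, H.left_apply]
  · simp [h.ee, h.ff, h.ef, h.fe, H.left_apply]
    rw [← pow_mul, ← sq, hb]
    ring
  · simp [h.ee, h.ff, h.ef, h.fe, H.left_apply]
    linear_combination hd

omit H in
theorem graphLine_inf_right (t : k × k × k) :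
    graphLine q e f t ⊓ Submodule.span k {f 0, f 1} = ⊥ := by
  rw [Submodule.eq_bot_iff]
  rintro v ⟨hv, hv'⟩
  obtain ⟨x, y, rfl⟩ := Submodule.mem_span_pair.mp hv
  obtain ⟨z, w, hzw⟩ := Submodule.mem_span_pair.mp hv'
  have h0 := congrArg (β (f 0)) hzw
  have h1 := congrArg (β (f 1)) hzw
  simp [h.ff, h.fe] at h0 h1
  simp [← h0, ← h1]

omit H in
-- The line is the graph of a map from the span of `e` to that of `f`, so it meets the former
-- exactly when the matrix with rows `(a, b)` and `(-b^q, d)` is singular.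
theorem graphLine_inf_left (t : k × k × k) :
    graphLine q e f t ⊓ Submodule.span k {e 0, e 1} ≠ ⊥ ↔ t.1 * t.2.2 + t.2.1 ^ (q + 1) = 0 := by
  obtain ⟨a, b, d⟩ := t
  rw [inf_ne_bot_iff]
  constructor
  · rintro ⟨v, hv, hv', hv0⟩
    obtain ⟨x, y, rfl⟩ := Submodule.mem_span_pair.mp hv
    obtain ⟨z, w, hzw⟩ := Submodule.mem_span_pair.mp hv'
    have h0 := congrArg (β (e 0)) hzw
    have h1 := congrArg (β (e 1)) hzw
    simp [h.ee, h.ef] at h0 h1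
    by_contra hdet
    have hx : x * (a * d + b ^ (q + 1)) = 0 := by linear_combination -d * h0 - b ^ q * h1
    have hy : y * (a * d + b ^ (q + 1)) = 0 := by linear_combination b * h0 - a * h1
    have hx' := (mul_eq_zero.mp hx).resolve_right hdet
    have hy' := (mul_eq_zero.mp hy).resolve_right hdet
    simp [hx', hy'] at hv0
  · intro hdet
    simp only at hdet
    by_cases hab : a = 0 ∧ b = 0
    · refine ⟨e 0, ?_, Submodule.subset_span (by simp), fun h0 => ?_⟩
      · exact Submodule.subset_span (by simp [hab])
      · have := h.ef 0 0
        simp [h0] at this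
    -- The row vector `(b ^ q, a)` kills the first column, and it kills the second when the
    -- determinant vanishes.
    · refine ⟨b ^ q • e 0 + a • e 1, ?_, Submodule.mem_span_pair.mpr ⟨_, _, rfl⟩, fun h0 => hab ?_⟩
      · refine Submodule.mem_span_pair.mpr ⟨b ^ q, a, ?_⟩
        have : b ^ q • (e 0 + a • f 0 + b • f 1) + a • (e 1 - b ^ q • f 0 + d • f 1) =
            b ^ q • e 0 + a • e 1 + (a * d + b ^ (q + 1)) • f 1 := by
          rw [pow_succ]
          module
        rw [this, hdet, zero_smul, add_zero]
      · have h1 := h.eq_zero (b ^ q) a 0 0 (by simpa using h0)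
        exact ⟨h1.2.1, eq_zero_of_pow_eq_zero h1.1⟩

omit H in
theorem graphLine_injective : Function.Injective (graphLine (k := k) q e f) := by
  rintro ⟨a, b, d⟩ ⟨a', b', d'⟩ heq
  have h1 : e 0 + a • f 0 + b • f 1 ∈ graphLine q e f (a', b', d') :=
    heq ▸ Submodule.subset_span (by simp)
  have h2 : e 1 - b ^ q • f 0 + d • f 1 ∈ graphLine q e f (a', b', d') :=
    heq ▸ Submodule.subset_span (by simp)
  obtain ⟨x, y, h1⟩ := Submodule.mem_span_pair.mp h1
  obtain ⟨z, w, h2⟩ := Submodule.mem_span_pair.mp h2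
  have h10 := congrArg (β (f 0)) h1
  have h11 := congrArg (β (f 1)) h1
  have h12 := congrArg (β (e 0)) h1
  have h13 := congrArg (β (e 1)) h1
  have h20 := congrArg (β (f 0)) h2
  have h21 := congrArg (β (f 1)) h2
  have h23 := congrArg (β (e 1)) h2
  simp [h.ee, h.ff, h.ef, h.fe] at h10 h11 h12 h13 h20 h21 h23
  subst h10 h11 h20 h21
  simp at h12 h13 h23
  simp [h12, h13, h23]

/-- A complement of the span of `f` is a graph with rows `(a, b)` and `(c, d)`. Isotropy says that
`a` and `d` are anti-fixed, that `c = -b^q`, and that `b + c^q = 0`, which becomes `b^(q²) = b`. -/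
theorem setOf_skew_right [IsAlgClosed k] :
    {N ∈ isotropicLines β | N ⊓ Submodule.span k {f 0, f 1} = ⊥} =
      graphLine q e f '' graphParams k q := by
  have := H.finite
  have hM : finrank k (Submodule.span k {f 0, f 1}) = 2 := by
    refine finrank_span_pair (LinearIndependent.pair_iff.mpr fun s t hst => ?_)
    exact (h.eq_zero 0 0 s t (by simpa using hst)).2.2
  ext N
  constructor
  · rintro ⟨hN, hNM⟩
    have hdec : ∀ i, ∃ z w : k, e i + z • f 0 + w • f 1 ∈ N := fun i => by
      obtain ⟨n, hn, m, hm, hnm⟩ := exists_add_eq_of_inf_eq_bot H.finrank_eq hN.1 hM hNM (e i)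
      obtain ⟨z, w, rfl⟩ := Submodule.mem_span_pair.mp hm
      refine ⟨-z, -w, ?_⟩
      have : e i + -z • f 0 + -w • f 1 = n := by rw [← hnm]; module
      rwa [this]
    obtain ⟨a, b, h1⟩ := hdec 0
    obtain ⟨c, d, h2⟩ := hdec 1
    have h11 := hN.2 _ h1 _ h1
    have h12 := hN.2 _ h1 _ h2
    have h21 := hN.2 _ h2 _ h1
    have h22 := hN.2 _ h2 _ h2
    simp [h.ee, h.ff, h.ef, h.fe, H.left_apply] at h11 h12 h21 h22
    have hc : c = -b ^ q := by linear_combination h12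
    subst hc
    refine ⟨(a, b, d), ⟨?_, ?_, ?_⟩, ?_⟩
    · rw [mem_antiFixed]; linear_combination h11
    · rw [mem_sqFixed, sq, pow_mul]
      rw [H.neg_pow] at h21
      linear_combination -h21
    · rw [mem_antiFixed]; linear_combination h22
    · refine (eq_span_pair_of_mem hN.1 ?_ h1 ?_).symm
      · rw [LinearIndependent.pair_iff]
        intro x y hxy
        have h0 := congrArg (β (f 0)) hxy
        have h1 := congrArg (β (f 1)) hxy
        simp [h.ff, h.fe] at h0 h1
        exact ⟨h0, h1⟩
      · simpa [sub_eq_add_neg] using h2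
  · rintro ⟨t, ht, rfl⟩
    exact ⟨H.graphLine_mem_isotropicLines h ht, graphLine_inf_right h t⟩

end

end IsFrobeniusForm

end FrobeniusForms

/-! ### Counting isotropic lines relative to a skew pair. -/

section FrobeniusForms

open Module

variable {k V : Type*} [Field k] [AddCommGroup V] [Module k V]

namespace IsFrobeniusForm

variable {q : ℕ} {σ τ : k →+* k} {β : V →ₛₗ[σ] V →ₗ[k] k} {ψ : V →ₛₗ[τ] V}

section
variable (H : IsFrobeniusForm q σ τ β ψ) {e f : Fin 2 → V} (h : IsHyperbolicFrame β e f)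
include H

theorem graphParams_finite_ncard [IsAlgClosed k] :
    (graphParams k q).Finite ∧ (graphParams k q).ncard = q ^ 4 := by
  obtain ⟨hK, hK'⟩ := H.antiFixed_finite_ncard
  obtain ⟨hF, hF'⟩ := H.sqFixed_finite_ncard
  refine ⟨hK.prod (hF.prod hK), ?_⟩
  rw [graphParams, Set.ncard_prod, Set.ncard_prod, hK', hF']
  ring

/-- If `a = 0` then `b = 0` and `d` is free, which gives `q` triples. If `a ≠ 0` then `d =
-b^(q+1)/a`, which is automatically anti-fixed because `b^(q+1)` equals its `q`-th power; this gives
`(q-1)q²` triples. -/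
theorem singular_graphParams [IsAlgClosed k] :
    {t ∈ graphParams k q | t.1 * t.2.2 + t.2.1 ^ (q + 1) = 0}.ncard = q + (q - 1) * q ^ 2 := by
  obtain ⟨hK, hK'⟩ := H.antiFixed_finite_ncard
  obtain ⟨hF, hF'⟩ := H.sqFixed_finite_ncard
  have h0 : (0 : k) ∈ antiFixed k q := by simp [mem_antiFixed, H.q_ne_zero]
  have hset : {t ∈ graphParams k q | t.1 * t.2.2 + t.2.1 ^ (q + 1) = 0} =
      ((fun d => ((0 : k), (0 : k), d)) '' antiFixed k q) ∪
        ((fun s : k × k => (s.1, s.2, -s.2 ^ (q + 1) / s.1)) ''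
          ((antiFixed k q \ {0}) ×ˢ sqFixed k q)) := by
    ext ⟨a, b, d⟩
    constructor
    · rintro ⟨⟨ha, hb, hd⟩, hdet⟩
      simp only at ha hb hd hdet
      by_cases ha0 : a = 0
      · subst ha0
        have hb0 : b = 0 := by simpa using hdet
        subst hb0
        exact Or.inl ⟨d, hd, rfl⟩
      · refine Or.inr ⟨(a, b), ⟨⟨ha, ha0⟩, hb⟩, ?_⟩
        simp only [Prod.mk.injEq, true_and]
        rw [div_eq_iff ha0]
        linear_combination -hdet
    · rintro (⟨d, hd, h⟩ | ⟨⟨a, b⟩, ⟨⟨ha, ha0⟩, hb⟩, h⟩)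
      · simp only [Prod.mk.injEq] at h
        obtain ⟨rfl, rfl, rfl⟩ := h
        refine ⟨⟨h0, ?_, hd⟩, by simp⟩
        simp [mem_sqFixed, H.q_ne_zero]
      · simp only [Prod.mk.injEq] at h
        obtain ⟨rfl, rfl, rfl⟩ := h
        simp only at ha ha0 hb
        rw [Set.mem_singleton_iff] at ha0
        refine ⟨⟨ha, hb, ?_⟩, ?_⟩
        · rw [mem_antiFixed] at ha ⊢
          rw [mem_sqFixed] at hb
          have ha' : a ^ q = -a := by linear_combination ha
          have hb' : (b ^ (q + 1)) ^ q = b ^ (q + 1) := by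
            calc (b ^ (q + 1)) ^ q = b ^ q ^ 2 * b ^ q := by ring
              _ = b ^ (q + 1) := by rw [hb, pow_succ']
          rw [div_pow, H.neg_pow, hb', ha']
          field_simp
          ring
        · field_simp
          ring
  rw [hset, Set.ncard_union_eq ?_ (hK.image _) ((hK.sdiff.prod hF).image _),
    Set.ncard_image_of_injective _ (fun x y hxy => by simpa using hxy),
    Set.ncard_image_of_injective _ (fun x y hxy => ?_), Set.ncard_prod,
    Set.ncard_sdiff_singleton_of_mem h0, hK', hF']
  · simp only [Prod.mk.injEq] at hxy
    exact Prod.ext hxy.1 hxy.2.1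
  · rw [Set.disjoint_left]
    rintro _ ⟨d, hd, rfl⟩ ⟨⟨a, b⟩, ⟨⟨ha, ha0⟩, hb⟩, h⟩
    simp only [Prod.mk.injEq] at h
    exact ha0 h.1

theorem finite_ncard_skew [IsAlgClosed k] {M : Submodule k V} (hM : M ∈ isotropicLines β) :
    {N ∈ isotropicLines β | N ⊓ M = ⊥}.Finite ∧
      {N ∈ isotropicLines β | N ⊓ M = ⊥}.ncard = q ^ 4 := by
  obtain ⟨L, hL, hML⟩ := H.exists_skew hM
  obtain ⟨f, e, h, rfl, rfl⟩ := H.exists_isHyperbolicFrame hM hL hML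
  obtain ⟨hP, hP'⟩ := H.graphParams_finite_ncard
  rw [H.setOf_skew_right h.symm, Set.ncard_image_of_injective _ (graphLine_injective h.symm)]
  exact ⟨hP.image _, hP'⟩

theorem ncard_skew_notSkew [IsAlgClosed k] {L M : Submodule k V} (hL : L ∈ isotropicLines β)
    (hM : M ∈ isotropicLines β) (hLM : L ⊓ M = ⊥) :
    {N ∈ isotropicLines β | N ⊓ M = ⊥ ∧ N ⊓ L ≠ ⊥}.ncard = q + (q - 1) * q ^ 2 := by
  obtain ⟨e, f, h, rfl, rfl⟩ := H.exists_isHyperbolicFrame hL hM hLM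
  rw [← H.singular_graphParams, ← Set.ncard_image_of_injective _ (graphLine_injective h)]
  congr 1
  have hset := H.setOf_skew_right h
  ext N
  constructor
  · rintro ⟨hN, hNM, hNL⟩
    obtain ⟨t, ht, rfl⟩ : N ∈ graphLine q e f '' graphParams k q := hset ▸ ⟨hN, hNM⟩
    exact ⟨t, ⟨ht, (graphLine_inf_left h t).mp hNL⟩, rfl⟩
  · rintro ⟨t, ⟨ht, ht'⟩, rfl⟩
    exact ⟨H.graphLine_mem_isotropicLines h ht, graphLine_inf_right h t,
      (graphLine_inf_left h t).mpr ht'⟩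

include h in
-- A transversal is spanned by a point on each line, orthogonal in both orders. One order determines
-- the second point from the first, `t • e 0 + e 1` giving `f 0 - t^q • f 1`; the other forces
-- `t^(q²) = t`. The inserted line is the case of the point `e 0`.
theorem setOf_transversals [IsAlgClosed k] :
    {N ∈ isotropicLines β | N ⊓ Submodule.span k {f 0, f 1} ≠ ⊥ ∧
        N ⊓ Submodule.span k {e 0, e 1} ≠ ⊥} =
      insert (Submodule.span k {e 0, f 1})
        ((fun t : k => Submodule.span k {t • e 0 + e 1, f 0 - t ^ q • f 1}) '' sqFixed k q) := by
  ext N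
  simp only [inf_ne_bot_iff]
  constructor
  · rintro ⟨hN, ⟨y, hyN, hy, hy0⟩, ⟨x, hxN, hx, hx0⟩⟩
    obtain ⟨s, t, rfl⟩ := Submodule.mem_span_pair.mp hx
    obtain ⟨z, w, rfl⟩ := Submodule.mem_span_pair.mp hy
    have hxy := hN.2 _ hxN _ hyN
    simp [h.ef, H.left_apply] at hxy
    by_cases ht : t = 0
    · subst ht
      have hs : s ≠ 0 := by rintro rfl; simp at hx0
      have hz : z = 0 := by simpa [H.q_ne_zero, hs] using hxy
      subst hz
      have hw : w ≠ 0 := by rintro rfl; simp at hy0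
      refine Or.inl (eq_span_pair_of_mem hN.1 (LinearIndependent.pair_iff.mpr fun a b hab => ?_)
        ?_ ?_)
      · have := h.eq_zero a 0 0 b (by simpa using hab)
        exact ⟨this.1, this.2.2.2⟩
      · simpa [hs] using N.smul_mem s⁻¹ hxN
      · simpa [hw] using N.smul_mem w⁻¹ hyN
    · have hz : z ≠ 0 := by
        rintro rfl
        have : w = 0 := by simpa [ht] using hxy
        simp [this] at hy0
      have h1 : (t⁻¹ * s) • e 0 + e 1 ∈ N := by
        have := N.smul_mem t⁻¹ hxN
        rwa [smul_add, smul_smul, smul_smul, inv_mul_cancel₀ ht, one_smul] at this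
      have h2 : f 0 + (z⁻¹ * w) • f 1 ∈ N := by
        have := N.smul_mem z⁻¹ hyN
        rwa [smul_add, smul_smul, smul_smul, inv_mul_cancel₀ hz, one_smul] at this
      generalize t⁻¹ * s = r at h1
      generalize z⁻¹ * w = c at h2
      have h12 := hN.2 _ h1 _ h2
      have h21 := hN.2 _ h2 _ h1
      simp [h.ef, h.fe, H.left_apply] at h12 h21
      obtain rfl : c = -r ^ q := by linear_combination h12
      refine Or.inr ⟨r, ?_, ?_⟩
      · rw [mem_sqFixed, sq, pow_mul]
        rw [H.neg_pow] at h21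
        linear_combination -h21
      · refine (eq_span_pair_of_mem hN.1 (LinearIndependent.pair_iff.mpr fun a b hab => ?_)
          h1 ?_).symm
        · have := h.eq_zero (a * r) a b (-b * r ^ q) (by
            rw [← hab]
            module)
          exact ⟨this.2.1, this.2.2.1⟩
        · simpa [sub_eq_add_neg] using h2
  · rintro (rfl | ⟨t, ht, rfl⟩)
    · have he0 : e 0 ≠ 0 := fun h0 => by simpa [h0] using h.ef 0 0
      have hf1 : f 1 ≠ 0 := fun h0 => by simpa [h0] using h.fe 1 1
      refine ⟨span_pair_mem_isotropicLines (LinearIndependent.pair_iff.mpr fun a b hab => ?_)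
        ?_ ?_ ?_ ?_, ⟨f 1, ?_, ?_, hf1⟩, ⟨e 0, ?_, ?_, he0⟩⟩
      · have := h.eq_zero a 0 0 b (by simpa using hab)
        exact ⟨this.1, this.2.2.2⟩
      all_goals first | exact Submodule.subset_span (by simp) | simp [h.ee, h.ef, h.fe, h.ff]
    · rw [mem_sqFixed, sq, pow_mul] at ht
      refine ⟨span_pair_mem_isotropicLines (LinearIndependent.pair_iff.mpr fun a b hab => ?_)
        ?_ ?_ ?_ ?_, ⟨f 0 - t ^ q • f 1, Submodule.subset_span (by simp), ?_, fun h0 => ?_⟩,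
        ⟨t • e 0 + e 1, Submodule.subset_span (by simp), ?_, fun h0 => ?_⟩⟩
      · have := h.eq_zero (a * t) a b (-b * t ^ q) (by
          rw [← hab]
          module)
        exact ⟨this.2.1, this.2.2.1⟩
      · simp [h.ee]
      · simp [h.ef, H.left_apply]
      · simp [h.fe, H.left_apply, ht]
      · simp [h.ff]
      · exact Submodule.mem_span_pair.mpr ⟨1, -t ^ q, by module⟩
      · have := congrArg (β (e 0)) h0
        simp [h.ef] at this
      · exact Submodule.mem_span_pair.mpr ⟨t, 1, by module⟩
      · have := congrArg (β (f 1)) h0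
        simp [h.fe] at this

theorem finite_ncard_transversals [IsAlgClosed k] {L M : Submodule k V}
    (hL : L ∈ isotropicLines β) (hM : M ∈ isotropicLines β) (hLM : L ⊓ M = ⊥) :
    {N ∈ isotropicLines β | N ⊓ M ≠ ⊥ ∧ N ⊓ L ≠ ⊥}.Finite ∧
      {N ∈ isotropicLines β | N ⊓ M ≠ ⊥ ∧ N ⊓ L ≠ ⊥}.ncard = q ^ 2 + 1 := by
  obtain ⟨e, f, h, rfl, rfl⟩ := H.exists_isHyperbolicFrame hL hM hLM
  obtain ⟨hF, hF'⟩ := H.sqFixed_finite_ncard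
  rw [H.setOf_transversals h]
  refine ⟨(hF.image _).insert _, ?_⟩
  rw [Set.ncard_insert_of_notMem ?_ (hF.image _), Set.ncard_image_of_injective, hF']
  · intro t t' heq
    have h1 : t • e 0 + e 1 ∈ Submodule.span k {t' • e 0 + e 1, f 0 - t' ^ q • f 1} :=
      Eq.subst (motive := fun T => t • e 0 + e 1 ∈ T) heq (Submodule.subset_span (by simp))
    obtain ⟨a, b, hab⟩ := Submodule.mem_span_pair.mp h1
    have h0 := congrArg (β (f 0)) hab
    have h1 := congrArg (β (f 1)) hab
    simp [h.fe, h.ff] at h0 h1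
    rw [h1, one_mul] at h0
    exact h0.symm
  · rintro ⟨t, -, heq⟩
    have h1 : e 0 ∈ Submodule.span k {t • e 0 + e 1, f 0 - t ^ q • f 1} := by
      rw [show Submodule.span k {t • e 0 + e 1, f 0 - t ^ q • f 1} = _ from heq]
      exact Submodule.subset_span (by simp)
    obtain ⟨a, b, hab⟩ := Submodule.mem_span_pair.mp h1
    have h0 := congrArg (β (f 0)) hab
    have h1 := congrArg (β (f 1)) hab
    simp [h.fe, h.ff] at h0 h1
    simp [h1] at h0

/-- Relative to a skew pair `L`, `M`, the lines skew to `M`, those meeting `M` but skew to `L`, and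
those meeting both number `q⁴`, `q + (q-1)q²` and `q² + 1`. -/
theorem finite_ncard_isotropicLines [IsAlgClosed k] :
    (isotropicLines β).Finite ∧ (isotropicLines β).ncard = (q + 1) * (q ^ 3 + 1) := by
  obtain ⟨L, hL⟩ := H.isotropicLines_nonempty
  obtain ⟨M, hM, hLM⟩ := H.exists_skew hL
  have hML : M ⊓ L = ⊥ := by rwa [inf_comm]
  obtain ⟨h1, h1'⟩ := H.finite_ncard_skew hM
  have h2' := H.ncard_skew_notSkew hM hL hML
  have h2 : {N ∈ isotropicLines β | N ⊓ L = ⊥ ∧ N ⊓ M ≠ ⊥}.Finite :=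
    (H.finite_ncard_skew hL).1.subset fun N hN => ⟨hN.1, hN.2.1⟩
  obtain ⟨h3, h3'⟩ := H.finite_ncard_transversals hL hM hLM
  have hS : isotropicLines β = {N ∈ isotropicLines β | N ⊓ M = ⊥} ∪
      ({N ∈ isotropicLines β | N ⊓ L = ⊥ ∧ N ⊓ M ≠ ⊥} ∪
        {N ∈ isotropicLines β | N ⊓ M ≠ ⊥ ∧ N ⊓ L ≠ ⊥}) := by
    ext N
    simp only [Set.mem_union, Set.mem_ofPred_eq]
    tauto
  rw [hS]
  refine ⟨h1.union (h2.union h3), ?_⟩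
  rw [Set.ncard_union_eq ?_ h1 (h2.union h3), Set.ncard_union_eq ?_ h2 h3, h1', h2', h3']
  · obtain ⟨n, rfl⟩ : ∃ n, q = n + 1 := ⟨q - 1, by have := H.two_le; lia⟩
    rw [Nat.add_sub_cancel]
    ring
  · rw [Set.disjoint_left]
    rintro N ⟨-, h, -⟩ ⟨-, -, h'⟩
    exact h' h
  · rw [Set.disjoint_left]
    rintro N ⟨-, h⟩ (⟨-, -, h'⟩ | ⟨-, h', -⟩) <;> exact h' h

theorem ncard_skew_skew [IsAlgClosed k] {L M : Submodule k V} (hL : L ∈ isotropicLines β)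
    (hM : M ∈ isotropicLines β) (hLM : L ⊓ M = ⊥) :
    {N ∈ isotropicLines β | N ⊓ M = ⊥ ∧ N ⊓ L = ⊥}.ncard = q * (q - 1) * (q ^ 2 + 1) := by
  obtain ⟨h1, h1'⟩ := H.finite_ncard_skew hM
  have h2 := H.ncard_skew_notSkew hL hM hLM
  have hS : {N ∈ isotropicLines β | N ⊓ M = ⊥} =
      {N ∈ isotropicLines β | N ⊓ M = ⊥ ∧ N ⊓ L ≠ ⊥} ∪
        {N ∈ isotropicLines β | N ⊓ M = ⊥ ∧ N ⊓ L = ⊥} := by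
    ext N
    simp only [Set.mem_union, Set.mem_ofPred_eq]
    tauto
  rw [hS, Set.ncard_union_eq ?_ (h1.subset fun N hN => ⟨hN.1, hN.2.1⟩)
    (h1.subset fun N hN => ⟨hN.1, hN.2.1⟩), h2] at h1'
  · obtain ⟨n, rfl⟩ : ∃ n, q = n + 1 := ⟨q - 1, by have := H.two_le; lia⟩
    rw [Nat.add_sub_cancel] at h1' ⊢
    have : (n + 1) ^ 4 = (n + 1 + n * (n + 1) ^ 2) + (n + 1) * n * ((n + 1) ^ 2 + 1) := by ring
    lia
  · rw [Set.disjoint_left]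
    rintro N ⟨-, -, h⟩ ⟨-, -, h'⟩
    exact h h'

end

end IsFrobeniusForm

end FrobeniusForms

/-! ### Rulings of a quadric. -/

section Reguli

open Module

variable {k V : Type*} [Field k] [AddCommGroup V] [Module k V]

/-- The line with parameter `w` of the ruling of a quadric that is spanned by the lines `⟨e 0, e 1⟩`
and `⟨g 0, g 1⟩`, identified with each other. -/
def rulingLine (e g : Fin 2 → V) (w : k × k) : Submodule k V :=
  Submodule.span k {w.1 • e 0 + w.2 • e 1, w.1 • g 0 + w.2 • g 1}

/-- Linear independence of the four vectors `e 0, e 1, g 0, g 1`. -/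
def IsIndependentFrame (k : Type*) [Field k] [Module k V] (e g : Fin 2 → V) : Prop :=
  ∀ x y z w : k, x • e 0 + y • e 1 + z • g 0 + w • g 1 = 0 → x = 0 ∧ y = 0 ∧ z = 0 ∧ w = 0

variable {e g : Fin 2 → V} (h : IsIndependentFrame k e g)

theorem mem_rulingLine {w : k × k} {v : V} : v ∈ rulingLine e g w ↔
    ∃ a b : k, v = a • (w.1 • e 0 + w.2 • e 1) + b • (w.1 • g 0 + w.2 • g 1) := by
  rw [rulingLine, Submodule.mem_span_pair]
  simp only [eq_comm]

include h

theorem IsIndependentFrame.ext {x y z w x' y' z' w' : k}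
    (heq : x • e 0 + y • e 1 + z • g 0 + w • g 1 = x' • e 0 + y' • e 1 + z' • g 0 + w' • g 1) :
    x = x' ∧ y = y' ∧ z = z' ∧ w = w' := by
  have := h (x - x') (y - y') (z - z') (w - w') (by
    rw [← sub_eq_zero] at heq
    rw [← heq]
    module)
  simpa only [sub_eq_zero] using this

theorem linearIndependent_rulingLine {w : k × k} (hw : w ≠ 0) :
    LinearIndependent k ![w.1 • e 0 + w.2 • e 1, w.1 • g 0 + w.2 • g 1] := by
  obtain ⟨s, t⟩ := w
  rw [LinearIndependent.pair_iff]
  intro a b hab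
  obtain ⟨h1, h2, h3, h4⟩ := h (a * s) (a * t) (b * s) (b * t) (by rw [← hab]; module)
  have : s ≠ 0 ∨ t ≠ 0 := by
    by_contra! h0
    exact hw (by simp [h0])
  rcases this with hs | ht
  · exact ⟨(mul_eq_zero.mp h1).resolve_right hs, (mul_eq_zero.mp h3).resolve_right hs⟩
  · exact ⟨(mul_eq_zero.mp h2).resolve_right ht, (mul_eq_zero.mp h4).resolve_right ht⟩

theorem rulingLine_inf_rulingLine {w w' : k × k} (hw : w.1 * w'.2 ≠ w.2 * w'.1) :
    rulingLine e g w ⊓ rulingLine e g w' = ⊥ := by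
  rw [Submodule.eq_bot_iff]
  rintro v ⟨hv, hv'⟩
  obtain ⟨a, b, rfl⟩ := mem_rulingLine.mp hv
  obtain ⟨c, d, heq⟩ := mem_rulingLine.mp hv'
  obtain ⟨h1, h2, h3, h4⟩ := h.ext (x := a * w.1) (y := a * w.2) (z := b * w.1) (w := b * w.2)
    (x' := c * w'.1) (y' := c * w'.2) (z' := d * w'.1) (w' := d * w'.2)
    ((by module : _ = _).trans (heq.trans (by module)))
  have ha : a * (w.1 * w'.2 - w.2 * w'.1) = 0 := by linear_combination w'.2 * h1 - w'.1 * h2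
  have hb : b * (w.1 * w'.2 - w.2 * w'.1) = 0 := by linear_combination w'.2 * h3 - w'.1 * h4
  rw [(mul_eq_zero.mp ha).resolve_right (sub_ne_zero.mpr hw),
    (mul_eq_zero.mp hb).resolve_right (sub_ne_zero.mpr hw)]
  simp

/-- A line that meets three lines of a ruling meets all of them. -/
theorem inf_rulingLine_ne_bot_of_three {K : Submodule k V} (hK : finrank k K = 2)
    {w₁ w₂ w₃ w : k × k} (h₁₂ : w₁.1 * w₂.2 ≠ w₁.2 * w₂.1) (h₁₃ : w₁.1 * w₃.2 ≠ w₁.2 * w₃.1)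
    (h₂₃ : w₂.1 * w₃.2 ≠ w₂.2 * w₃.1) (hw : w ≠ 0) (hK₁ : K ⊓ rulingLine e g w₁ ≠ ⊥)
    (hK₂ : K ⊓ rulingLine e g w₂ ≠ ⊥) (hK₃ : K ⊓ rulingLine e g w₃ ≠ ⊥) :
    K ⊓ rulingLine e g w ≠ ⊥ := by
  rw [inf_ne_bot_iff] at hK₁ hK₂ hK₃ ⊢
  obtain ⟨x₁, hx₁, hx₁', hx₁0⟩ := hK₁
  obtain ⟨x₂, hx₂, hx₂', hx₂0⟩ := hK₂
  obtain ⟨x₃, hx₃, hx₃', hx₃0⟩ := hK₃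
  have hspan := eq_span_pair_of_mem hK (linearIndependent_pair_of_mem_of_mem
    (rulingLine_inf_rulingLine h h₁₂) hx₁' hx₂' hx₁0 hx₂0) hx₁ hx₂
  obtain ⟨p, r, hpr⟩ := Submodule.mem_span_pair.mp (hspan ▸ hx₃)
  obtain ⟨a₁, b₁, rfl⟩ := mem_rulingLine.mp hx₁'
  obtain ⟨a₂, b₂, rfl⟩ := mem_rulingLine.mp hx₂'
  obtain ⟨a₃, b₃, rfl⟩ := mem_rulingLine.mp hx₃'
  obtain ⟨h1, h2, h3, h4⟩ := h.ext (x := p * a₁ * w₁.1 + r * a₂ * w₂.1)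
    (y := p * a₁ * w₁.2 + r * a₂ * w₂.2) (z := p * b₁ * w₁.1 + r * b₂ * w₂.1)
    (w := p * b₁ * w₁.2 + r * b₂ * w₂.2) (x' := a₃ * w₃.1) (y' := a₃ * w₃.2) (z' := b₃ * w₃.1)
    (w' := b₃ * w₃.2) ((by module : _ = _).trans (hpr.trans (by module)))
  have hne : a₃ ≠ 0 ∨ b₃ ≠ 0 := by
    by_contra! h0
    exact hx₃0 (by simp [h0])
  -- Cramer's rule applied to `x₃ = p x₁ + r x₂` shows that, up to scalars, all three points have
  -- the coordinates `(a₃, b₃)` on their ruling lines.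
  set D := w₁.1 * w₂.2 - w₁.2 * w₂.1
  have hD : D ≠ 0 := sub_ne_zero.mpr h₁₂
  set D₁ := w₃.1 * w₂.2 - w₃.2 * w₂.1
  have hD₁ : D₁ ≠ 0 := fun h0 => h₂₃ (by linear_combination -h0)
  set D₂ := w₁.1 * w₃.2 - w₁.2 * w₃.1
  have hD₂ : D₂ ≠ 0 := sub_ne_zero.mpr h₁₃
  have e1 : p * a₁ * D = a₃ * D₁ := by linear_combination w₂.2 * h1 - w₂.1 * h2
  have e2 : p * b₁ * D = b₃ * D₁ := by linear_combination w₂.2 * h3 - w₂.1 * h4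
  have e3 : r * a₂ * D = a₃ * D₂ := by linear_combination w₁.1 * h2 - w₁.2 * h1
  have e4 : r * b₂ * D = b₃ * D₂ := by linear_combination w₁.1 * h4 - w₁.2 * h3
  -- The points with fixed `(a₃, b₃)` trace a line of the opposite ruling. It shares two points with
  -- `K`, so all its points lie in `K`.
  set y : k × k → V := fun w => a₃ • (w.1 • e 0 + w.2 • e 1) + b₃ • (w.1 • g 0 + w.2 • g 1)
    with hy
  have hy₁ : y w₁ ∈ K := by
    have : y w₁ = (D₁⁻¹ * p * D) • (a₁ • (w₁.1 • e 0 + w₁.2 • e 1) +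
        b₁ • (w₁.1 • g 0 + w₁.2 • g 1)) := by
      rw [smul_add, smul_smul _ a₁, smul_smul _ b₁,
        show D₁⁻¹ * p * D * a₁ = a₃ by field_simp; linear_combination e1,
        show D₁⁻¹ * p * D * b₁ = b₃ by field_simp; linear_combination e2]
    exact this ▸ K.smul_mem _ hx₁
  have hy₂ : y w₂ ∈ K := by
    have : y w₂ = (D₂⁻¹ * r * D) • (a₂ • (w₂.1 • e 0 + w₂.2 • e 1) +
        b₂ • (w₂.1 • g 0 + w₂.2 • g 1)) := by
      rw [smul_add, smul_smul _ a₂, smul_smul _ b₂,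
        show D₂⁻¹ * r * D * a₂ = a₃ by field_simp; linear_combination e3,
        show D₂⁻¹ * r * D * b₂ = b₃ by field_simp; linear_combination e4]
    exact this ▸ K.smul_mem _ hx₂
  refine ⟨y w, ?_, mem_rulingLine.mpr ⟨a₃, b₃, rfl⟩, fun h0 => ?_⟩
  · have : y w = (D⁻¹ * (w.1 * w₂.2 - w.2 * w₂.1)) • y w₁ +
        (D⁻¹ * (w₁.1 * w.2 - w₁.2 * w.1)) • y w₂ := by
      have f1 : w.1 = D⁻¹ * (w.1 * w₂.2 - w.2 * w₂.1) * w₁.1 +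
          D⁻¹ * (w₁.1 * w.2 - w₁.2 * w.1) * w₂.1 := by
        field_simp
        ring
      have f2 : w.2 = D⁻¹ * (w.1 * w₂.2 - w.2 * w₂.1) * w₁.2 +
          D⁻¹ * (w₁.1 * w.2 - w₁.2 * w.1) * w₂.2 := by
        field_simp
        ring
      generalize D⁻¹ * (w.1 * w₂.2 - w.2 * w₂.1) = c at f1 f2
      generalize D⁻¹ * (w₁.1 * w.2 - w₁.2 * w.1) = d at f1 f2
      simp only [hy]
      rw [f1, f2]
      module
    rw [this]
    exact add_mem (K.smul_mem _ hy₁) (K.smul_mem _ hy₂)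
  · have := LinearIndependent.pair_iff.mp (linearIndependent_rulingLine h hw) a₃ b₃ h0
    exact hne.elim (fun h => h this.1) fun h => h this.2

end Reguli

/-! ### Common transversals of three skew lines. -/

section FrobeniusForms

open Module

variable {k V : Type*} [Field k] [AddCommGroup V] [Module k V]

namespace IsFrobeniusForm

variable {q : ℕ} {σ τ : k →+* k} {β : V →ₛₗ[σ] V →ₗ[k] k} {ψ : V →ₛₗ[τ] V}

/-- The lines of `isotropicLines β` that meet three given lines. -/
def transversals {σ : k →+* k} (β : V →ₛₗ[σ] V →ₗ[k] k) (L M N : Submodule k V) :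
    Set (Submodule k V) :=
  {T ∈ isotropicLines β | T ⊓ L ≠ ⊥ ∧ T ⊓ M ≠ ⊥ ∧ T ⊓ N ≠ ⊥}

section
variable (H : IsFrobeniusForm q σ τ β ψ) {L M N : Submodule k V} (hL : L ∈ isotropicLines β)
  (hM : M ∈ isotropicLines β) (hN : N ∈ isotropicLines β) (hLM : L ⊓ M = ⊥) (hLN : L ⊓ N = ⊥)
  (hMN : M ⊓ N = ⊥)
include H hL hM hN hLM hLN hMN

/-- `N` is the graph of an isomorphism from `L` to `M`, which carries a basis `e` to `g`. The
freedom in the basis is used to choose `e 0` as a zero of the form `β x (g x)` of degree `q + 1` on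
`L`. -/
theorem exists_frame_of_three_skew [IsAlgClosed k] : ∃ e g : Fin 2 → V, IsIndependentFrame k e g ∧
    L = Submodule.span k {e 0, e 1} ∧ M = Submodule.span k {g 0, g 1} ∧
    N = Submodule.span k {e 0 + g 0, e 1 + g 1} ∧ β (e 0) (g 0) = 0 := by
  have := H.finite
  obtain ⟨u, v, huv, hLuv⟩ := exists_eq_span_pair hL.1
  have hu : u ∈ L := hLuv ▸ Submodule.subset_span (by simp)
  have hv : v ∈ L := hLuv ▸ Submodule.subset_span (by simp)
  have hdec : ∀ x : V, ∃ m ∈ M, x + m ∈ N := fun x => by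
    obtain ⟨m, hm, n, hn, hmn⟩ := exists_add_eq_of_inf_eq_bot H.finrank_eq hM.1 hN.1 hMN x
    exact ⟨-m, neg_mem hm, by rwa [← hmn, add_neg_cancel_comm]⟩
  obtain ⟨a, ha, hua⟩ := hdec u
  obtain ⟨b, hb, hvb⟩ := hdec v
  obtain ⟨s, t, hst, h0⟩ := exists_isotropic_coords H.two_le (β u a) (β u b) (β v a) (β v b)
  obtain ⟨e', g', he', hg', heg', hli⟩ : ∃ e' g', e' ∈ L ∧ g' ∈ M ∧ e' + g' ∈ N ∧
      LinearIndependent k ![s • u + t • v, e'] := by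
    by_cases hs : s = 0
    · have ht : t ≠ 0 := by simpa [hs] using hst
      refine ⟨u, a, hu, ha, hua, LinearIndependent.pair_iff.mpr fun x y hxy => ?_⟩
      have := LinearIndependent.pair_iff.mp huv (x * s + y) (x * t) (by rw [← hxy]; module)
      have hx : x = 0 := (mul_eq_zero.mp this.2).resolve_right ht
      exact ⟨hx, by simpa [hx] using this.1⟩
    · refine ⟨v, b, hv, hb, hvb, LinearIndependent.pair_iff.mpr fun x y hxy => ?_⟩
      have := LinearIndependent.pair_iff.mp huv (x * s) (x * t + y) (by rw [← hxy]; module)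
      have hx : x = 0 := (mul_eq_zero.mp this.1).resolve_right hs
      exact ⟨hx, by simpa [hx] using this.2⟩
  have he0 : s • u + t • v ∈ L := add_mem (L.smul_mem _ hu) (L.smul_mem _ hv)
  have hg0 : s • a + t • b ∈ M := add_mem (M.smul_mem _ ha) (M.smul_mem _ hb)
  have heg0 : s • u + t • v + (s • a + t • b) ∈ N := by
    have : s • u + t • v + (s • a + t • b) = s • (u + a) + t • (v + b) := by module
    exact this ▸ add_mem (N.smul_mem _ hua) (N.smul_mem _ hvb)
  have hβ : β (s • u + t • v) (s • a + t • b) = 0 := by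
    simp only [map_add, LinearMap.map_smulₛₗ, LinearMap.add_apply, LinearMap.smul_apply,
      H.left_apply, map_smul, smul_eq_mul]
    linear_combination h0
  generalize s • u + t • v = e₀ at *
  generalize s • a + t • b = g₀ at *
  have hind : IsIndependentFrame k ![e₀, e'] ![g₀, g'] := by
    intro x y z w hxyzw
    simp only [Matrix.cons_val_zero, Matrix.cons_val_one] at hxyzw
    have h1 : x • e₀ + y • e' = 0 := by
      refine (Submodule.eq_bot_iff _).mp hLM _
        ⟨add_mem (L.smul_mem _ he0) (L.smul_mem _ he'), ?_⟩
      have : x • e₀ + y • e' = -(z • g₀ + w • g') := by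
        rw [eq_neg_iff_add_eq_zero, ← add_assoc, hxyzw]
      exact this ▸ neg_mem (add_mem (M.smul_mem _ hg0) (M.smul_mem _ hg'))
    have h2 : z • g₀ + w • g' = 0 := by
      rwa [h1, zero_add] at hxyzw
    have h3 : z • e₀ + w • e' = 0 := by
      refine (Submodule.eq_bot_iff _).mp hLN _
        ⟨add_mem (L.smul_mem _ he0) (L.smul_mem _ he'), ?_⟩
      have : z • e₀ + w • e' = z • (e₀ + g₀) + w • (e' + g') := by
        rw [smul_add, smul_add, add_add_add_comm, h2, add_zero]
      exact this ▸ add_mem (N.smul_mem _ heg0) (N.smul_mem _ heg')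
    have h4 := LinearIndependent.pair_iff.mp hli x y h1
    have h5 := LinearIndependent.pair_iff.mp hli z w h3
    exact ⟨h4.1, h4.2, h5.1, h5.2⟩
  refine ⟨![e₀, e'], ![g₀, g'], hind, eq_span_pair_of_mem hL.1 hli he0 he',
    eq_span_pair_of_mem hM.1 (LinearIndependent.pair_iff.mpr fun z w hzw => ?_) hg0 hg',
    eq_span_pair_of_mem hN.1 (LinearIndependent.pair_iff.mpr fun z w hzw => ?_) heg0 heg', hβ⟩
  · exact (hind 0 0 z w (by simpa using hzw)).2.2
  · have := hind z w z w (by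
      simp only [Matrix.cons_val_zero, Matrix.cons_val_one]
      rw [← hzw]
      simp only [Matrix.cons_val_zero, Matrix.cons_val_one]
      module)
    exact ⟨this.1, this.2.1⟩

/-- Three skew lines have `q + 1` common transversals, which belong to a ruling of a quadric. -/
theorem transversals_eq_image_rulingLine [IsAlgClosed k] : ∃ (e g : Fin 2 → V) (W : Set (k × k)),
    IsIndependentFrame k e g ∧ transversals β L M N = rulingLine e g '' W ∧ W.Finite ∧
    W.ncard = q + 1 ∧ (0 : k × k) ∉ W ∧
    ∀ w ∈ W, ∀ w' ∈ W, w ≠ w' → w.1 * w'.2 ≠ w.2 * w'.1 := by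
  obtain ⟨e, g, hind, rfl, rfl, rfl, h00⟩ :=
    H.exists_frame_of_three_skew hL hM hN hLM hLN hMN
  have he : ∀ i, e i ∈ Submodule.span k {e 0, e 1} := fun i => by
    fin_cases i <;> exact Submodule.subset_span (by simp)
  have hg : ∀ i, g i ∈ Submodule.span k {g 0, g 1} := fun i => by
    fin_cases i <;> exact Submodule.subset_span (by simp)
  have heg : ∀ i, e i + g i ∈ Submodule.span k {e 0 + g 0, e 1 + g 1} := fun i => by
    fin_cases i <;> exact Submodule.subset_span (by simp)
  have hee : ∀ i j, β (e i) (e j) = 0 := fun i j => hL.2 _ (he i) _ (he j)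
  have hgg : ∀ i j, β (g i) (g j) = 0 := fun i j => hM.2 _ (hg i) _ (hg j)
  have hge : ∀ i j, β (g i) (e j) = -β (e i) (g j) := fun i j => by
    have := hN.2 _ (heg i) _ (heg j)
    simp only [map_add, LinearMap.add_apply, hee, hgg] at this
    linear_combination this
  have hcoords := exists_coords_of_finrank_eq_four H.finrank_eq hind
  have hnondeg : ∀ x y : k, β (x • e 0 + y • e 1) (g 0) = 0 → β (x • e 0 + y • e 1) (g 1) = 0 →
      x = 0 ∧ y = 0 := fun x y h1 h2 => by
    have h0 : x • e 0 + y • e 1 = 0 := H.eq_zero_of_left fun v => by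
      obtain ⟨x', y', z', w', rfl⟩ := hcoords v
      rw [map_add, map_add, map_add, map_smul, map_smul, map_smul _ z', map_smul _ w', h1, h2]
      simp [hee]
    have := hind x y 0 0 (by simpa using h0)
    exact ⟨this.1, this.2.1⟩
  have h01 : β (e 0) (g 1) ≠ 0 := fun h1 => by
    simpa using hnondeg 1 0 (by simp [h00]) (by simp [h1])
  -- Otherwise `x • e 0 + e 1` lies in the left radical for the `x` chosen here.
  have h10 : β (e 1) (g 0) ≠ 0 := fun h1 => by
    obtain ⟨x, hx⟩ := IsAlgClosed.exists_pow_nat_eq (-β (e 1) (g 1) / β (e 0) (g 1))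
      (Nat.pos_of_ne_zero H.q_ne_zero)
    simpa using hnondeg x 1 (by simp [h00, h1]) (by
      simp only [map_add, LinearMap.map_smulₛₗ, LinearMap.add_apply, LinearMap.smul_apply,
        H.left_apply, hx, smul_eq_mul]
      field_simp
      simp)
  -- The ruling line with parameter `(s, t)` is isotropic when a single form of degree `q + 1`
  -- vanishes. As `β (e 0) (g 0) = 0`, this form vanishes at `(1, 0)`, and its zeros with `t = 1`
  -- are the `q` roots of this separable trinomial.
  obtain ⟨hR, hR'⟩ := Polynomial.ncard_trinomial_eq_zero H.two_le H.cast_eq_zero h01 h10 (β (e 1) (g 1))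
  set R := {t | β (e 0) (g 1) * t ^ q + β (e 1) (g 0) * t + β (e 1) (g 1) = 0} with hRdef
  have hinj : Function.Injective fun t : k => (t, (1 : k)) := fun a b hab => by simpa using hab
  refine ⟨e, g, insert (1, 0) ((fun t : k => (t, (1 : k))) '' R), hind, ?_,
    (hR.image _).insert _, ?_, ?_, ?_⟩
  · have hiff : ∀ w : k × k, w ≠ 0 → (rulingLine e g w ∈ transversals β (Submodule.span k {e 0, e 1})
        (Submodule.span k {g 0, g 1}) (Submodule.span k {e 0 + g 0, e 1 + g 1}) ↔
        w.2 * w.1 ^ q * β (e 0) (g 1) + w.1 * w.2 ^ q * β (e 1) (g 0) +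
          w.2 * w.2 ^ q * β (e 1) (g 1) = 0) := fun w hw => by
      have hli := linearIndependent_rulingLine hind hw
      have hβ : β (w.1 • e 0 + w.2 • e 1) (w.1 • g 0 + w.2 • g 1) =
          w.2 * w.1 ^ q * β (e 0) (g 1) + w.1 * w.2 ^ q * β (e 1) (g 0) +
          w.2 * w.2 ^ q * β (e 1) (g 1) := by
        simp only [map_add, LinearMap.map_smulₛₗ, LinearMap.add_apply, LinearMap.smul_apply,
          H.left_apply, map_smul, smul_eq_mul, h00]
        ring
      have hβ' : β (w.1 • g 0 + w.2 • g 1) (w.1 • e 0 + w.2 • e 1) =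
          -β (w.1 • e 0 + w.2 • e 1) (w.1 • g 0 + w.2 • g 1) := by
        simp only [map_add, LinearMap.map_smulₛₗ, LinearMap.add_apply, LinearMap.smul_apply,
          H.left_apply, map_smul, smul_eq_mul, hge]
        ring
      rw [← hβ]
      constructor
      · exact fun hT => hT.1.2 _ (Submodule.subset_span (by simp)) _
          (Submodule.subset_span (by simp))
      · intro h0
        have h1 := add_mem (Submodule.smul_mem _ w.1 (he 0)) (Submodule.smul_mem _ w.2 (he 1))
        have h2 := add_mem (Submodule.smul_mem _ w.1 (hg 0)) (Submodule.smul_mem _ w.2 (hg 1))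
        have h3 := add_mem (Submodule.smul_mem _ w.1 (heg 0)) (Submodule.smul_mem _ w.2 (heg 1))
        have hT1 : w.1 • e 0 + w.2 • e 1 ∈ rulingLine e g w := Submodule.subset_span (by simp)
        have hT2 : w.1 • g 0 + w.2 • g 1 ∈ rulingLine e g w := Submodule.subset_span (by simp)
        refine ⟨span_pair_mem_isotropicLines hli (hL.2 _ h1 _ h1) h0 (by rw [hβ', h0, neg_zero])
          (hM.2 _ h2 _ h2), ?_, ?_, ?_⟩ <;> rw [inf_ne_bot_iff]
        · exact ⟨_, hT1, h1, by simpa using hli.ne_zero 0⟩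
        · exact ⟨_, hT2, h2, by simpa using hli.ne_zero 1⟩
        · refine ⟨_, add_mem hT1 hT2, ?_, fun hz => ?_⟩
          · have : w.1 • e 0 + w.2 • e 1 + (w.1 • g 0 + w.2 • g 1) =
                w.1 • (e 0 + g 0) + w.2 • (e 1 + g 1) := by module
            exact this ▸ h3
          · have := LinearIndependent.pair_iff.mp hli 1 1 (by simpa using hz)
            exact one_ne_zero this.1
    ext T
    constructor
    · intro hT
      obtain ⟨w, hwW, hwT, hw0⟩ : ∃ w : k × k, (w = (1, 0) ∨ w.2 = 1) ∧ T = rulingLine e g w ∧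
          w ≠ 0 := by
        obtain ⟨hT, hTL, hTM, hTN⟩ := hT
        rw [inf_ne_bot_iff] at hTL hTM hTN
        obtain ⟨x, hx, hxL, hx0⟩ := hTL
        obtain ⟨y, hy, hyM, hy0⟩ := hTM
        obtain ⟨n, hn, hnN, hn0⟩ := hTN
        have hspan := eq_span_pair_of_mem hT.1
          (linearIndependent_pair_of_mem_of_mem hLM hxL hyM hx0 hy0) hx hy
        obtain ⟨a, b, hab⟩ := Submodule.mem_span_pair.mp (hspan ▸ hn)
        obtain ⟨x₀, x₁, rfl⟩ := Submodule.mem_span_pair.mp hxL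
        obtain ⟨y₀, y₁, rfl⟩ := Submodule.mem_span_pair.mp hyM
        obtain ⟨s, t, rfl⟩ := Submodule.mem_span_pair.mp hnN
        -- Decomposing the point on `N` along `L` and `M` shows that the points of `T` on these two
        -- lines correspond under the identification of `e` with `g`.
        obtain ⟨h1, h2, h3, h4⟩ := IsIndependentFrame.ext hind (x := a * x₀) (y := a * x₁)
          (z := b * y₀) (w := b * y₁) (x' := s) (y' := t) (z' := s) (w' := t)
          ((by module : _ = _).trans (hab.trans (by module)))
        have hsT : s • e 0 + t • e 1 ∈ T := by
          rw [← h1, ← h2]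
          have := T.smul_mem a hx
          rwa [smul_add, smul_smul, smul_smul] at this
        have htT : s • g 0 + t • g 1 ∈ T := by
          nth_rewrite 1 [← h3]
          rw [← h4]
          have := T.smul_mem b hy
          rwa [smul_add, smul_smul, smul_smul] at this
        by_cases ht : t = 0
        · subst ht
          have hs : s ≠ 0 := by rintro rfl; simp at hn0
          have hw0 : ((1, 0) : k × k) ≠ 0 := by simp
          refine ⟨(1, 0), Or.inl rfl, eq_span_pair_of_mem hT.1
            (linearIndependent_rulingLine hind hw0) ?_ ?_, hw0⟩
          · simpa [hs] using T.smul_mem s⁻¹ hsT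
          · simpa [hs] using T.smul_mem s⁻¹ htT
        · have hw0 : ((t⁻¹ * s, 1) : k × k) ≠ 0 := by simp
          refine ⟨(t⁻¹ * s, 1), Or.inr rfl, eq_span_pair_of_mem hT.1
            (linearIndependent_rulingLine hind hw0) ?_ ?_, hw0⟩
          · simpa [ht, smul_smul] using T.smul_mem t⁻¹ hsT
          · simpa [ht, smul_smul] using T.smul_mem t⁻¹ htT
      subst hwT
      refine ⟨w, ?_, rfl⟩
      rcases hwW with rfl | hw
      · exact Or.inl rfl
      · obtain ⟨t, _⟩ := w
        obtain rfl := hw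
        refine Or.inr ⟨t, ?_, rfl⟩
        have := (hiff _ hw0).mp hT
        simp only [one_pow, mul_one, one_mul] at this
        rw [hRdef, Set.mem_ofPred_eq]
        linear_combination this
    · rintro ⟨w, rfl | ⟨t, ht, rfl⟩, rfl⟩
      · exact (hiff _ (by simp)).mpr (by simp [H.q_ne_zero])
      · refine (hiff _ (by simp)).mpr ?_
        rw [hRdef, Set.mem_ofPred_eq] at ht
        simp only [one_pow, mul_one, one_mul]
        linear_combination ht
  · rw [Set.ncard_insert_of_notMem (by simp) (hR.image _), Set.ncard_image_of_injective _ hinj, hR']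
  · simp [Prod.ext_iff]
  · rintro w (rfl | ⟨t, -, rfl⟩) w' (rfl | ⟨t', -, rfl⟩) hne
    · exact absurd rfl hne
    · simp
    · simp
    · simpa using hne

theorem ncard_transversals [IsAlgClosed k] : (transversals β L M N).ncard = q + 1 := by
  obtain ⟨e, g, W, hind, heq, hW, hcard, h0, hdet⟩ :=
    H.transversals_eq_image_rulingLine hL hM hN hLM hLN hMN
  rw [heq, Set.InjOn.ncard_image, hcard]
  intro w hw w' hw' hww'
  by_contra hne
  have h1 := rulingLine_inf_rulingLine hind (hdet w hw w' hw' hne)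
  rw [← hww', inf_idem] at h1
  have h2 := finrank_span_pair (linearIndependent_rulingLine hind (w := w) fun h => h0 (h ▸ hw))
  rw [rulingLine] at h1
  rw [h1, finrank_bot] at h2
  lia

theorem transversals_pairwise_skew [IsAlgClosed k] :
    (transversals β L M N).Pairwise fun T T' => T ⊓ T' = ⊥ := by
  obtain ⟨e, g, W, hind, heq, hW, hcard, h0, hdet⟩ :=
    H.transversals_eq_image_rulingLine hL hM hN hLM hLN hMN
  rw [heq]
  rintro _ ⟨w, hw, rfl⟩ _ ⟨w', hw', rfl⟩ hne
  exact rulingLine_inf_rulingLine hind (hdet w hw w' hw' fun h => hne (h ▸ rfl))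

/-- A line that meets three common transversals of three skew lines meets all of them. -/
theorem inf_ne_bot_of_mem_transversals [IsAlgClosed k] {K T₁ T₂ T₃ T : Submodule k V}
    (hT₁ : T₁ ∈ transversals β L M N) (hT₂ : T₂ ∈ transversals β L M N)
    (hT₃ : T₃ ∈ transversals β L M N) (hT : T ∈ transversals β L M N) (h₁₂ : T₁ ≠ T₂)
    (h₁₃ : T₁ ≠ T₃) (h₂₃ : T₂ ≠ T₃) (hK : K ∈ transversals β T₁ T₂ T₃) : K ⊓ T ≠ ⊥ := by
  obtain ⟨e, g, W, hind, heq, hW, hcard, h0, hdet⟩ :=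
    H.transversals_eq_image_rulingLine hL hM hN hLM hLN hMN
  rw [heq] at hT₁ hT₂ hT₃ hT
  obtain ⟨w₁, hw₁, rfl⟩ := hT₁
  obtain ⟨w₂, hw₂, rfl⟩ := hT₂
  obtain ⟨w₃, hw₃, rfl⟩ := hT₃
  obtain ⟨w, hw, rfl⟩ := hT
  exact inf_rulingLine_ne_bot_of_three hind hK.1.1
    (hdet _ hw₁ _ hw₂ fun h => h₁₂ (h ▸ rfl)) (hdet _ hw₁ _ hw₃ fun h => h₁₃ (h ▸ rfl))
    (hdet _ hw₂ _ hw₃ fun h => h₂₃ (h ▸ rfl)) (fun h => h0 (h ▸ hw)) hK.2.1 hK.2.2.1 hK.2.2.2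

end

end IsFrobeniusForm

end FrobeniusForms

/-! ### Double counting in an abstract geometry of reguli. -/

section Counting

variable {α γ : Type*}

theorem ncard_eq_ncard_mul_of_fiber {s : Set α} {t : Set γ} (f : α → γ) (hs : s.Finite)
    (ht : t.Finite) (hf : Set.MapsTo f s t) {n : ℕ} (hn : ∀ b ∈ t, {a ∈ s | f a = b}.ncard = n) :
    s.ncard = t.ncard * n := by
  classical
  lift s to Finset α using hs
  lift t to Finset γ using ht
  rw [Set.ncard_coe_finset, Set.ncard_coe_finset, Finset.card_eq_sum_card_fiberwise hf,
    ← smul_eq_mul, ← Finset.sum_const]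
  refine Finset.sum_congr rfl fun b hb => ?_
  rw [← hn b hb, ← Set.ncard_coe_finset]
  congr 1
  ext a
  simp

/-- The ordered triples of elements of `S` that are pairwise related by `R`. -/
def relatedTriples (S : Set α) (R : α → α → Prop) : Set (α × α × α) :=
  {t | (t.1 ∈ S ∧ t.2.1 ∈ S ∧ t.2.2 ∈ S) ∧ R t.1 t.2.1 ∧ R t.1 t.2.2 ∧ R t.2.1 t.2.2}

theorem relatedTriples_finite {S : Set α} (hS : S.Finite) (R : α → α → Prop) :
    (relatedTriples S R).Finite :=
  (hS.prod (hS.prod hS)).subset fun _ ht => ⟨ht.1.1, ht.1.2.1, ht.1.2.2⟩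

theorem ncard_relatedTriples {S : Set α} (hS : S.Finite) {R : α → α → Prop} {n₂ n₃ : ℕ}
    (h₂ : ∀ x ∈ S, {y ∈ S | R x y}.ncard = n₂)
    (h₃ : ∀ x ∈ S, ∀ y ∈ S, R x y → {z ∈ S | R x z ∧ R y z}.ncard = n₃) :
    (relatedTriples S R).ncard = S.ncard * n₂ * n₃ := by
  have hP : {p : α × α | p ∈ S ×ˢ S ∧ R p.1 p.2}.Finite := (hS.prod hS).subset fun _ h => h.1
  rw [ncard_eq_ncard_mul_of_fiber (t := {p : α × α | p ∈ S ×ˢ S ∧ R p.1 p.2})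
    (fun t => (t.1, t.2.1)) (relatedTriples_finite hS R) hP (n := n₃),
    ncard_eq_ncard_mul_of_fiber (t := S) (fun p => p.1) hP hS (n := n₂)]
  · exact fun p hp => hp.1.1
  · intro x hx
    rw [← h₂ x hx, ← Set.ncard_image_of_injective {y ∈ S | R x y} (Prod.mk_right_injective x)]
    refine congrArg Set.ncard ?_
    ext ⟨a, b⟩
    constructor
    · rintro ⟨⟨⟨ha, hb⟩, hab⟩, rfl⟩
      exact ⟨b, ⟨hb, hab⟩, rfl⟩
    · rintro ⟨y, ⟨hy, hxy⟩, heq⟩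
      obtain ⟨rfl, rfl⟩ := Prod.mk.inj heq
      exact ⟨⟨⟨hx, hy⟩, hxy⟩, rfl⟩
  · exact fun t ht => ⟨⟨ht.1.1, ht.1.2.1⟩, ht.2.1⟩
  · rintro ⟨x, y⟩ ⟨⟨hx, hy⟩, hxy⟩
    rw [← h₃ x hx y hy hxy, ← Set.ncard_image_of_injective {z ∈ S | R x z ∧ R y z}
      ((Prod.mk_right_injective x).comp (Prod.mk_right_injective y))]
    refine congrArg Set.ncard ?_
    ext ⟨a, b, c⟩
    constructor
    · rintro ⟨⟨⟨ha, hb, hc⟩, hab, hac, hbc⟩, heq⟩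
      obtain ⟨rfl, rfl⟩ := Prod.mk.inj heq
      exact ⟨c, ⟨hc, hac, hbc⟩, rfl⟩
    · rintro ⟨z, ⟨hz, hxz, hyz⟩, heq⟩
      obtain ⟨rfl, h⟩ := Prod.mk.inj heq
      obtain ⟨rfl, rfl⟩ := Prod.mk.inj h
      exact ⟨⟨⟨hx, hy, hz⟩, hxy, hxz, hyz⟩, rfl⟩

theorem ncard_relatedTriples_ne {A : Set α} (hA : A.Finite) :
    (relatedTriples A (· ≠ ·)).ncard = A.ncard * (A.ncard - 1) * (A.ncard - 2) := by
  refine ncard_relatedTriples hA (fun x hx => ?_) fun x hx y hy hxy => ?_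
  · rw [← Set.ncard_sdiff_singleton_of_mem hx]
    congr 1
    ext y
    simp [eq_comm]
  · have hy' : y ∈ A \ {x} := ⟨hy, hxy.symm⟩
    rw [show A.ncard - 2 = A.ncard - 1 - 1 by lia, ← Set.ncard_sdiff_singleton_of_mem hx,
      ← Set.ncard_sdiff_singleton_of_mem hy']
    congr 1
    ext z
    simp only [Set.mem_sdiff, Set.mem_singleton_iff, Set.mem_ofPred_eq, and_assoc, ne_eq, eq_comm]

/-- The elements of `S` that are not related to any of `L`, `M`, `N`. -/
def commonNonrelated (S : Set α) (R : α → α → Prop) (L M N : α) : Set α :=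
  {T ∈ S | ¬ R T L ∧ ¬ R T M ∧ ¬ R T N}

/-- Two sets of `d` pairwise related elements of `S` such that no element of the first one is
related to an element of the second one. -/
structure IsDoubleSet (S : Set α) (R : α → α → Prop) (d : ℕ) (A B : Set α) : Prop where
  left_subset : A ⊆ S
  right_subset : B ⊆ S
  left_ncard : A.ncard = d
  right_ncard : B.ncard = d
  left_pairwise : A.Pairwise R
  right_pairwise : B.Pairwise R
  not_rel : ∀ L ∈ A, ∀ M ∈ B, ¬ R L M

/-- A finite set with a symmetric relation such that the elements not related to three pairwise
related elements form reguli with `d` elements. -/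
structure IsRegularGeometry (S : Set α) (R : α → α → Prop) (d : ℕ) : Prop where
  finite : S.Finite
  three_le : 3 ≤ d
  symm {x y : α} : R x y → R y x
  irrefl {x : α} : x ∈ S → ¬ R x x
  ncard_commonNonrelated {L M N : α} : L ∈ S → M ∈ S → N ∈ S → R L M → R L N → R M N →
    (commonNonrelated S R L M N).ncard = d
  pairwise_commonNonrelated {L M N : α} : L ∈ S → M ∈ S → N ∈ S → R L M → R L N → R M N →
    (commonNonrelated S R L M N).Pairwise R
  not_rel_of_three {L M N T₁ T₂ T₃ T K : α} : L ∈ S → M ∈ S → N ∈ S → R L M → R L N → R M N →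
    T₁ ∈ commonNonrelated S R L M N → T₂ ∈ commonNonrelated S R L M N →
    T₃ ∈ commonNonrelated S R L M N → T ∈ commonNonrelated S R L M N → T₁ ≠ T₂ → T₁ ≠ T₃ →
    T₂ ≠ T₃ → K ∈ commonNonrelated S R T₁ T₂ T₃ → ¬ R K T

theorem exists_three_of_ncard {A : Set α} (hA : 3 ≤ A.ncard) :
    ∃ x ∈ A, ∃ y ∈ A, ∃ z ∈ A, x ≠ y ∧ x ≠ z ∧ y ≠ z := by
  have hfin : A.Finite := Set.finite_of_ncard_pos (by lia)
  obtain ⟨x, y, z, hx, hy, hz, h⟩ := (Set.two_lt_ncard_iff hfin).mp hA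
  exact ⟨x, hx, y, hy, z, hz, h⟩

namespace IsDoubleSet

variable {S : Set α} {R : α → α → Prop} {d : ℕ} {A B : Set α}

theorem symm (h : IsDoubleSet S R d A B) (hR : ∀ {x y}, R x y → R y x) : IsDoubleSet S R d B A :=
  ⟨h.right_subset, h.left_subset, h.right_ncard, h.left_ncard, h.right_pairwise, h.left_pairwise,
    fun L hL M hM hLM => h.not_rel M hM L hL (hR hLM)⟩

/-- The inclusion of `B` is immediate, and both sides have `d` elements. -/
theorem eq_commonNonrelated (hG : IsRegularGeometry S R d) (h : IsDoubleSet S R d A B) {L M N : α}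
    (hL : L ∈ A) (hM : M ∈ A) (hN : N ∈ A) (hLM : L ≠ M) (hLN : L ≠ N) (hMN : M ≠ N) :
    B = commonNonrelated S R L M N := by
  refine Set.eq_of_subset_of_ncard_le (fun T hT => ⟨h.right_subset hT,
    fun hr => h.not_rel L hL T hT (hG.symm hr), fun hr => h.not_rel M hM T hT (hG.symm hr),
    fun hr => h.not_rel N hN T hT (hG.symm hr)⟩) ?_ (hG.finite.subset fun T hT => hT.1)
  rw [h.right_ncard, hG.ncard_commonNonrelated (h.left_subset hL) (h.left_subset hM)
    (h.left_subset hN) (h.left_pairwise hL hM hLM) (h.left_pairwise hL hN hLN)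
    (h.left_pairwise hM hN hMN)]

theorem left_eq (hG : IsRegularGeometry S R d) (h : IsDoubleSet S R d A B) :
    A = {K ∈ S | ∀ T ∈ B, ¬ R K T} := by
  obtain ⟨T₁, h₁, T₂, h₂, T₃, h₃, h₁₂, h₁₃, h₂₃⟩ :=
    exists_three_of_ncard (h.right_ncard ▸ hG.three_le)
  refine Set.Subset.antisymm (fun K hK => ⟨h.left_subset hK, h.not_rel K hK⟩) fun K hK => ?_
  rw [(h.symm hG.symm).eq_commonNonrelated hG h₁ h₂ h₃ h₁₂ h₁₃ h₂₃]
  exact ⟨hK.1, hK.2 _ h₁, hK.2 _ h₂, hK.2 _ h₃⟩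

theorem disjoint (hG : IsRegularGeometry S R d) (h : IsDoubleSet S R d A B) : Disjoint A B := by
  rw [Set.disjoint_left]
  intro L hLA hLB
  obtain ⟨M, hM, hML⟩ := Set.exists_ne_of_one_lt_ncard
    (by rw [h.left_ncard]; have := hG.three_le; lia) L
  exact h.not_rel M hM L hLB (h.left_pairwise hM hLA hML)

/-- The family containing `L` is recovered from the union as `L` together with the elements related
to `L`; the other family is the complement. -/
theorem eq_of_union_eq (hG : IsRegularGeometry S R d) (h : IsDoubleSet S R d A B) {A' B' : Set α}
    (h' : IsDoubleSet S R d A' B') (hU : A ∪ B = A' ∪ B') {L : α} (hL : L ∈ A) (hL' : L ∈ A') :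
    A = A' ∧ B = B' := by
  have key : ∀ {A B}, IsDoubleSet S R d A B → L ∈ A → A = {K ∈ A ∪ B | K = L ∨ R K L} := by
    intro A B h hL
    ext K
    constructor
    · intro hK
      refine ⟨Or.inl hK, ?_⟩
      by_cases hKL : K = L
      · exact Or.inl hKL
      · exact Or.inr (h.left_pairwise hK hL hKL)
    · rintro ⟨hK | hK, hKL⟩
      · exact hK
      · rcases hKL with rfl | hKL
        · exact hL
        · exact absurd (hG.symm hKL) (h.not_rel L hL K hK)
  have hA : A = A' := by rw [key h hL, key h' hL', hU]
  subst hA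
  refine ⟨rfl, ?_⟩
  rw [← Set.union_sdiff_cancel_left (h.disjoint hG).le_bot, hU,
    Set.union_sdiff_cancel_left (h'.disjoint hG).le_bot]

end IsDoubleSet

namespace IsRegularGeometry

variable {S : Set α} {R : α → α → Prop} {d : ℕ} (hG : IsRegularGeometry S R d)
include hG

/-- Pick three elements of the opposite family, which is possible as `d ≥ 3`. Whatever is unrelated
to these three is unrelated to the whole family, so the first family is again a set of common
nonrelated elements and inherits its size and pairwise relations. -/
theorem isDoubleSet_of_three {L M N : α} (hL : L ∈ S) (hM : M ∈ S) (hN : N ∈ S) (hLM : R L M)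
    (hLN : R L N) (hMN : R M N) :
    IsDoubleSet S R d {K ∈ S | ∀ T ∈ commonNonrelated S R L M N, ¬ R K T}
      (commonNonrelated S R L M N) := by
  have hcard := hG.ncard_commonNonrelated hL hM hN hLM hLN hMN
  have hpair := hG.pairwise_commonNonrelated hL hM hN hLM hLN hMN
  obtain ⟨T₁, h₁, T₂, h₂, T₃, h₃, h₁₂, h₁₃, h₂₃⟩ :=
    exists_three_of_ncard (hcard ▸ hG.three_le)
  have heq : {K ∈ S | ∀ T ∈ commonNonrelated S R L M N, ¬ R K T} =
      commonNonrelated S R T₁ T₂ T₃ := by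
    ext K
    exact ⟨fun hK => ⟨hK.1, hK.2 _ h₁, hK.2 _ h₂, hK.2 _ h₃⟩, fun hK => ⟨hK.1, fun T hT =>
      hG.not_rel_of_three hL hM hN hLM hLN hMN h₁ h₂ h₃ hT h₁₂ h₁₃ h₂₃ hK⟩⟩
  have r₁₂ := hpair h₁ h₂ h₁₂
  have r₁₃ := hpair h₁ h₃ h₁₃
  have r₂₃ := hpair h₂ h₃ h₂₃
  refine ⟨fun K hK => hK.1, fun T hT => hT.1, ?_, hcard, ?_, hpair, fun K hK => hK.2⟩
  · rw [heq, hG.ncard_commonNonrelated h₁.1 h₂.1 h₃.1 r₁₂ r₁₃ r₂₃]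
  · rw [heq]
    exact hG.pairwise_commonNonrelated h₁.1 h₂.1 h₃.1 r₁₂ r₁₃ r₂₃

/-- Each related triple determines a double set, and the fibre over `(A, B)` consists of the ordered
triples of distinct elements of `A`. -/
theorem finite_ncard_isDoubleSet :
    {P : Set α × Set α | IsDoubleSet S R d P.1 P.2}.Finite ∧
      (relatedTriples S R).ncard =
        {P : Set α × Set α | IsDoubleSet S R d P.1 P.2}.ncard * (d * (d - 1) * (d - 2)) := by
  have hfin : {P : Set α × Set α | IsDoubleSet S R d P.1 P.2}.Finite :=
    (hG.finite.finite_subsets.prod hG.finite.finite_subsets).subset fun P hP =>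
      ⟨hP.left_subset, hP.right_subset⟩
  refine ⟨hfin, ncard_eq_ncard_mul_of_fiber
    (fun t => ({K ∈ S | ∀ T ∈ commonNonrelated S R t.1 t.2.1 t.2.2, ¬ R K T},
      commonNonrelated S R t.1 t.2.1 t.2.2)) (relatedTriples_finite hG.finite R) hfin ?_ ?_⟩
  · rintro ⟨L, M, N⟩ ⟨⟨hL, hM, hN⟩, hLM, hLN, hMN⟩
    exact hG.isDoubleSet_of_three hL hM hN hLM hLN hMN
  · rintro ⟨A, B⟩ hAB
    have hAB : IsDoubleSet S R d A B := hAB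
    rw [← hAB.left_ncard, ← ncard_relatedTriples_ne (hG.finite.subset hAB.left_subset)]
    congr 1
    ext ⟨L, M, N⟩
    constructor
    · rintro ⟨⟨⟨hL, hM, hN⟩, hLM, hLN, hMN⟩, heq⟩
      obtain ⟨rfl, rfl⟩ := Prod.mk.inj heq
      have hne : ∀ {x y}, x ∈ S → R x y → x ≠ y := by
        rintro x _ hx hxy rfl
        exact hG.irrefl hx hxy
      exact ⟨⟨⟨hL, fun T hT hr => hT.2.1 (hG.symm hr)⟩, ⟨hM, fun T hT hr => hT.2.2.1 (hG.symm hr)⟩,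
        ⟨hN, fun T hT hr => hT.2.2.2 (hG.symm hr)⟩⟩, hne hL hLM, hne hL hLN, hne hM hMN⟩
    · rintro ⟨⟨hL, hM, hN⟩, hLM, hLN, hMN⟩
      simp only at hL hM hN hLM hLN hMN
      have hB := hAB.eq_commonNonrelated hG hL hM hN hLM hLN hMN
      refine ⟨⟨⟨hAB.left_subset hL, hAB.left_subset hM, hAB.left_subset hN⟩,
        hAB.left_pairwise hL hM hLM, hAB.left_pairwise hL hN hLN, hAB.left_pairwise hM hN hMN⟩, ?_⟩
      simp only
      rw [← hB, ← hAB.left_eq hG]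

/-- Each union of a double set arises from exactly two ordered double sets. -/
theorem finite_ncard_unions :
    {C | ∃ A B, C = A ∪ B ∧ IsDoubleSet S R d A B}.Finite ∧
      {P : Set α × Set α | IsDoubleSet S R d P.1 P.2}.ncard =
        {C | ∃ A B, C = A ∪ B ∧ IsDoubleSet S R d A B}.ncard * 2 := by
  have hfin : {C | ∃ A B, C = A ∪ B ∧ IsDoubleSet S R d A B}.Finite :=
    hG.finite.finite_subsets.subset (by
      rintro _ ⟨A, B, rfl, h⟩
      exact Set.union_subset h.left_subset h.right_subset)
  refine ⟨hfin, ncard_eq_ncard_mul_of_fiber (fun P => P.1 ∪ P.2)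
    hG.finite_ncard_isDoubleSet.1 hfin (fun P hP => ⟨P.1, P.2, rfl, hP⟩) ?_⟩
  rintro _ ⟨A, B, rfl, h⟩
  have hset : {P ∈ {P : Set α × Set α | IsDoubleSet S R d P.1 P.2} | P.1 ∪ P.2 = A ∪ B} =
      {(A, B), (B, A)} := by
    ext ⟨A', B'⟩
    constructor
    · rintro ⟨h', hU⟩
      have h' : IsDoubleSet S R d A' B' := h'
      have hU : A' ∪ B' = A ∪ B := hU
      obtain ⟨L, hL⟩ : A'.Nonempty := Set.nonempty_of_ncard_ne_zero (by
        rw [h'.left_ncard]; have := hG.three_le; lia)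
      rcases (hU ▸ Or.inl hL : L ∈ A ∪ B) with hL' | hL'
      · obtain ⟨rfl, rfl⟩ := h'.eq_of_union_eq hG h hU hL hL'
        exact Or.inl rfl
      · obtain ⟨rfl, rfl⟩ :=
          h'.eq_of_union_eq hG (h.symm hG.symm) (hU.trans (Set.union_comm _ _)) hL hL'
        exact Or.inr rfl
    · rintro (heq | heq) <;> obtain ⟨rfl, rfl⟩ := Prod.mk.inj heq
      · exact ⟨h, rfl⟩
      · exact ⟨h.symm hG.symm, Set.union_comm _ _⟩
  rw [hset, Set.ncard_pair]
  intro heq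
  obtain ⟨h1, -⟩ := Prod.mk.inj heq
  subst h1
  have h0 := (h.disjoint hG).eq_bot_of_self
  have := h.left_ncard
  rw [h0, Set.bot_eq_empty, Set.ncard_empty] at this
  have := hG.three_le
  lia

end IsRegularGeometry

end Counting

/-! ### The count for a Frobenius form. -/

namespace IsFrobeniusForm

variable {k V : Type*} [Field k] [IsAlgClosed k] [AddCommGroup V] [Module k V] {q : ℕ}
  {σ τ : k →+* k} {β : V →ₛₗ[σ] V →ₗ[k] k} {ψ : V →ₛₗ[τ] V}

/-- With skewness as the relation, `commonNonrelated` unfolds to `transversals`. -/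
theorem isRegularGeometry (H : IsFrobeniusForm q σ τ β ψ) :
    IsRegularGeometry (isotropicLines β) (fun L M => L ⊓ M = ⊥) (q + 1) where
  finite := H.finite_ncard_isotropicLines.1
  three_le := by have := H.two_le; lia
  symm h := by rwa [inf_comm]
  irrefl {L} hL h := by
    have h1 := hL.1
    rw [inf_idem] at h
    rw [h, finrank_bot] at h1
    lia
  ncard_commonNonrelated hL hM hN hLM hLN hMN := H.ncard_transversals hL hM hN hLM hLN hMN
  pairwise_commonNonrelated hL hM hN hLM hLN hMN :=
    H.transversals_pairwise_skew hL hM hN hLM hLN hMN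
  not_rel_of_three hL hM hN hLM hLN hMN h₁ h₂ h₃ h h₁₂ h₁₃ h₂₃ hK :=
    H.inf_ne_bot_of_mem_transversals hL hM hN hLM hLN hMN h₁ h₂ h₃ h h₁₂ h₁₃ h₂₃ hK

theorem ncard_relatedTriples_isotropicLines (H : IsFrobeniusForm q σ τ β ψ) :
    (relatedTriples (isotropicLines β) fun L M => L ⊓ M = ⊥).ncard =
      (q + 1) * (q ^ 3 + 1) * q ^ 4 * (q * (q - 1) * (q ^ 2 + 1)) := by
  obtain ⟨hS, hS'⟩ := H.finite_ncard_isotropicLines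
  rw [← hS']
  refine ncard_relatedTriples hS (fun M hM => ?_) fun L hL M hM hLM => ?_
  · simpa only [inf_comm] using (H.finite_ncard_skew hM).2
  · rw [← H.ncard_skew_skew hL hM hLM]
    congr 1
    ext N
    simp only [Set.mem_ofPred_eq, inf_comm N]
    tauto

/-- The number of skew triples is divided by the `(q+1)q(q-1)` triples in one family, a positive
number because `q ≥ 2`. -/
theorem finite_ncard_unions (H : IsFrobeniusForm q σ τ β ψ) :
    {C | ∃ A B, C = A ∪ B ∧
        IsDoubleSet (isotropicLines β) (fun L M => L ⊓ M = ⊥) (q + 1) A B}.Finite ∧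
      {C | ∃ A B, C = A ∪ B ∧
          IsDoubleSet (isotropicLines β) (fun L M => L ⊓ M = ⊥) (q + 1) A B}.ncard * 2 =
        (q ^ 3 + 1) * (q ^ 2 + 1) * q ^ 4 := by
  obtain ⟨h1, h1'⟩ := H.isRegularGeometry.finite_ncard_isDoubleSet
  obtain ⟨h2, h2'⟩ := H.isRegularGeometry.finite_ncard_unions
  refine ⟨h2, ?_⟩
  rw [H.ncard_relatedTriples_isotropicLines, h2', Nat.add_sub_cancel,
    show q + 1 - 2 = q - 1 by lia] at h1'
  have hq := H.two_le
  have hpos : 0 < (q + 1) * q * (q - 1) :=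
    Nat.mul_pos (Nat.mul_pos (by lia) (by lia)) (by lia)
  refine Nat.eq_of_mul_eq_mul_right hpos (h1'.symm.trans ?_)
  ring

end IsFrobeniusForm

/-! ### The Frobenius form of an invertible matrix. -/

section MatrixForm

variable {k : Type*} [Field k] (p e : ℕ) [Fact p.Prime] [CharP k p]

/-- The form `∑ u i ^ p ^ e * A i j * v j` of a matrix. -/
noncomputable def matrixFrobeniusForm (A : Matrix (Fin 4) (Fin 4) k) :
    (Fin 4 → k) →ₛₗ[iterateFrobenius k p e] (Fin 4 → k) →ₗ[k] k :=
  LinearMap.mk₂'ₛₗ _ (RingHom.id k) (fun u v => ∑ i, u i ^ p ^ e * A.mulVec v i)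
    (fun u u' v => by simp [add_pow_char_pow, add_mul, Finset.sum_add_distrib])
    (fun c u v => by simp [iterateFrobenius_def, mul_pow, mul_assoc, Finset.mul_sum])
    (fun u v v' => by simp [Matrix.mulVec_add, mul_add, Finset.sum_add_distrib])
    (fun c u v => by simp [Matrix.mulVec_smul, Finset.mul_sum, mul_left_comm])

/-- The adjunction of `matrixFrobeniusForm`. -/
noncomputable def matrixFrobeniusAdj (A : Matrix (Fin 4) (Fin 4) k) :
    (Fin 4 → k) →ₛₗ[(iterateFrobenius k p e).comp (iterateFrobenius k p e)] (Fin 4 → k) where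
  toFun v := A⁻¹.mulVec fun i => (∑ j, v j ^ p ^ e * A j i) ^ p ^ e
  map_add' u v := by
    rw [← Matrix.mulVec_add]
    congr 1
    ext i
    simp [add_pow_char_pow, add_mul, Finset.sum_add_distrib]
  map_smul' c v := by
    rw [← Matrix.mulVec_smul]
    congr 1
    ext i
    simp only [Pi.smul_apply, smul_eq_mul, RingHom.comp_apply, iterateFrobenius_def, mul_pow,
      mul_assoc]
    rw [← Finset.mul_sum, mul_pow]

theorem matrixFrobeniusForm_apply (A : Matrix (Fin 4) (Fin 4) k) (u v : Fin 4 → k) :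
    matrixFrobeniusForm p e A u v = ∑ i, u i ^ p ^ e * A.mulVec v i := rfl

theorem matrixFrobeniusAdj_apply (A : Matrix (Fin 4) (Fin 4) k) (v : Fin 4 → k) :
    matrixFrobeniusAdj p e A v =
      A⁻¹.mulVec fun i => (∑ j, v j ^ p ^ e * A j i) ^ p ^ e := rfl

theorem eq_zero_of_matrixFrobeniusForm {A : Matrix (Fin 4) (Fin 4) k} (hA : IsUnit A)
    {u : Fin 4 → k} (hu : ∀ v, matrixFrobeniusForm p e A u v = 0) : u = 0 := by
  have hdet := (Matrix.isUnit_iff_isUnit_det A).mp hA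
  ext l
  have h := hu (A⁻¹.mulVec (Pi.single l 1))
  rw [matrixFrobeniusForm_apply, Matrix.mulVec_mulVec, Matrix.mul_nonsing_inv A hdet,
    Matrix.one_mulVec] at h
  simp only [Pi.single_apply, mul_ite, mul_one, mul_zero, Finset.sum_ite_eq', Finset.mem_univ,
    if_true] at h
  exact eq_zero_of_pow_eq_zero h

theorem matrixFrobeniusForm_adj {A : Matrix (Fin 4) (Fin 4) k} (hA : IsUnit A)
    (u v : Fin 4 → k) : matrixFrobeniusForm p e A u (matrixFrobeniusAdj p e A v) =
      matrixFrobeniusForm p e A v u ^ p ^ e := by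
  have hdet := (Matrix.isUnit_iff_isUnit_det A).mp hA
  rw [matrixFrobeniusForm_apply, matrixFrobeniusForm_apply, matrixFrobeniusAdj_apply,
    Matrix.mulVec_mulVec, Matrix.mul_nonsing_inv A hdet, Matrix.one_mulVec]
  simp only [← mul_pow]
  rw [← sum_pow_char_pow]
  congr 1
  simp only [Matrix.mulVec, dotProduct, Finset.mul_sum]
  rw [Finset.sum_comm]
  exact Finset.sum_congr rfl fun i _ => Finset.sum_congr rfl fun j _ => by ring

theorem isFrobeniusForm_matrix (he : e ≠ 0) {A : Matrix (Fin 4) (Fin 4) k} (hA : IsUnit A) :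
    IsFrobeniusForm (p ^ e) (iterateFrobenius k p e)
      ((iterateFrobenius k p e).comp (iterateFrobenius k p e)) (matrixFrobeniusForm p e A)
      (matrixFrobeniusAdj p e A) where
  two_le := (Fact.out : p.Prime).two_le.trans (Nat.le_self_pow he p)
  cast_eq_zero := by simp [he]
  left_apply x := iterateFrobenius_def ..
  adj_apply x := by
    rw [RingHom.comp_apply, iterateFrobenius_def, iterateFrobenius_def, ← pow_mul, sq]
  finrank_eq := by simp
  eq_zero_of_left hu := eq_zero_of_matrixFrobeniusForm p e hA hu
  adj u v := matrixFrobeniusForm_adj p e hA u v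

theorem eval_eq_matrixFrobeniusForm {F : MvPolynomial (Fin 4) k} {A : Matrix (Fin 4) (Fin 4) k}
    (hF : F = ∑ i, ∑ j, C (A i j) * (X i ^ p ^ e * X j)) (v : Fin 4 → k) :
    eval v F = matrixFrobeniusForm p e A v v := by
  rw [matrixFrobeniusForm_apply]
  simp only [hF, map_sum, map_mul, eval_C, map_pow, eval_X, Matrix.mulVec, dotProduct,
    Finset.mul_sum]
  exact Finset.sum_congr rfl fun i _ => Finset.sum_congr rfl fun j _ => by ring

end MatrixForm

/-! ### Quadric configurations as unions of double sets, and the conclusion. -/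

theorem isQuadricConfiguration_iff {k : Type*} [Field k] {F : MvPolynomial (Fin 4) k} {d : ℕ}
    {S : Set (Submodule k (Fin 4 → k))} (hS : ∀ L, IsLineOn F L ↔ L ∈ S)
    (hG : IsRegularGeometry S (fun L M => L ⊓ M = ⊥) d) {C : Set (Submodule k (Fin 4 → k))} :
    IsQuadricConfiguration F d C ↔
      ∃ A B, C = A ∪ B ∧ IsDoubleSet S (fun L M => L ⊓ M = ⊥) d A B := by
  constructor
  · rintro ⟨hC, -, A, B, rfl, hA, hB, hA', hB', hAB⟩
    exact ⟨A, B, rfl, fun L hL => (hS L).mp (hC L (Or.inl hL)),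
      fun L hL => (hS L).mp (hC L (Or.inr hL)), hA, hB, hA', hB', hAB⟩
  · rintro ⟨A, B, rfl, h⟩
    refine ⟨fun L hL => (hS L).mpr (hL.elim (h.left_subset ·) (h.right_subset ·)), ?_, A, B, rfl,
      h.left_ncard, h.right_ncard, h.left_pairwise, h.right_pairwise, h.not_rel⟩
    -- The clause on `2 * d` lines is automatic, since the two families are disjoint.
    rw [Set.ncard_union_eq (h.disjoint hG) (hG.finite.subset h.left_subset)
      (hG.finite.subset h.right_subset), h.left_ncard, h.right_ncard, two_mul]

/-- A smooth extremal surface of degree `q + 1`, where `q` is a positive power of the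
characteristic, contains exactly `(q³ + 1)(q² + 1)q⁴ / 2` quadric configurations. -/
theorem mainTheorem7 {k : Type*} [Field k] [IsAlgClosed k] (p : ℕ) [Fact p.Prime] [CharP k p]
    (e q : ℕ) (he : 1 ≤ e) (hq : q = p ^ e) (F : MvPolynomial (Fin 4) k)
    (hF : IsExtremalForm p (q + 1) F) (hsmooth : IsSmoothSurface F) :
    {C : Set (Submodule k (Fin 4 → k)) | IsQuadricConfiguration F (q + 1) C}.Finite ∧
      ({C : Set (Submodule k (Fin 4 → k)) | IsQuadricConfiguration F (q + 1) C}.ncard : ℚ) =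
        1 / 2 * ((q : ℚ) ^ 3 + 1) * ((q : ℚ) ^ 2 + 1) * (q : ℚ) ^ 4 := by
  subst hq
  have he0 : e ≠ 0 := by lia
  obtain ⟨A, hA⟩ := exists_matrix_of_isExtremalForm he0 hF
  have H := isFrobeniusForm_matrix p e he0 (isUnit_of_isSmoothSurface he0 hsmooth A hA)
  have hlines : ∀ L, IsLineOn F L ↔ L ∈ isotropicLines (matrixFrobeniusForm p e A) := fun L => by
    rw [H.mem_isotropicLines_iff, IsLineOn]
    simp only [eval_eq_matrixFrobeniusForm p e hA]
  simp only [isQuadricConfiguration_iff hlines H.isRegularGeometry]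
  obtain ⟨hfin, hcard⟩ := H.finite_ncard_unions
  refine ⟨hfin, ?_⟩
  have hcard' := congrArg (Nat.cast : ℕ → ℚ) hcard
  push_cast at hcard' ⊢
  linear_combination hcard' / 2
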